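/- Let $N\ge 1$ be an integer, $s>0$, $\beta_L,\beta_R\in(0,1)$, and put $\rho_L=\beta_L/(1-\beta_L)$, $\rho_R=\beta_R/(1-\beta_R)$. All operators are real infinite matrices indexed by $m=(m_1,\dots,m_N)\in\mathbb N_0^N$, specified by their action on the basis vectors $|m\rangle$; products, exponentials and power series are taken entry by entry. Let $\delta_i$ be the $i$-th unit configuration and, for $i=1,\dots,N$, $$S_+^{[i]}|m\rangle=(m_i+2s)|m+\delta_i\rangle,\quad S_-^{[i]}|m\rangle=m_i|m-\delta_i\rangle,\quad S_0^{[i]}|m\rangle=(m_i+s)|m\rangle,\qquad S_a^{\mathrm{tot}}=\sum_{i=1}^N S_a^{[i]}\ (a\in\{+,-,0\}).$$ For integers $k,n\ge 1$ let $\varphi_s(k,n)=\frac1k\frac{\Gamma(n+1)\Gamma(n-k+2s)}{\Gamma(n-k+1)\Gamma(n+2s)}$ if $k\le n$ and $\varphi_s(k,n)=0$ otherwise, let $h_s(n)=\sum_{k=1}^n\varphi_s(k,n)$ for $n\ge 0$, and let $\psi=\Gamma'/\Gamma$. Define $$\mathcal H_{i,i+1}|m\rangle=(h_s(m_i)+h_s(m_{i+1}))|m\rangle-\sum_{k=1}^{m_i}\varphi_s(k,m_i)|m-k\delta_i+k\delta_{i+1}\rangle-\sum_{k=1}^{m_{i+1}}\varphi_s(k,m_{i+1})|m+k\delta_i-k\delta_{i+1}\rangle,$$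 $$\mathcal B_i|m\rangle=\Big(h_s(m_i)+\sum_{k=1}^\infty\frac{\beta_i^k}{k}\Big)|m\rangle-\sum_{k=1}^{m_i}\varphi_s(k,m_i)|m-k\delta_i\rangle-\sum_{k=1}^\infty\frac{\beta_i^k}{k}|m+k\delta_i\rangle,$$ where the first-site term $\mathcal B_1$ is taken with $\beta_L$ and the last-site term $\mathcal B_N$ with $\beta_R$ (for $N=1$ these are two terms acting on the same site, and there is no bulk term). Let $H=\mathcal B_1+\sum_{i=1}^{N-1}\mathcal H_{i,i+1}+\mathcal B_N$ and $$H'=e^{S_-^{\mathrm{tot}}}He^{-S_-^{\mathrm{tot}}},\qquad H''=e^{-\rho_RS_+^{\mathrm{tot}}}H'e^{\rho_RS_+^{\mathrm{tot}}},$$ where triple products are formed from left to right. Let $H^\circ$ be the Hamiltonian with both boundaries diagonal, $$H^\circ=\mathcal B_1^\circ+\sum_{i=1}^{N-1}\mathcal H_{i,i+1}+\mathcal B_N^\circ,\qquad \mathcal B_i^\circ=\psi(S_0^{[i]}+s)-\psi(2s)\quad(i\in\{1,N\}).$$ Finally let $$Q_+=sS_+^{\mathrm{tot}}+\sum_{i=1}^NS_+^{[i]}\Big(S_0^{[i]}+2\sum_{j=i+1}^NS_0^{[j]}\Big),\qquad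 \mathcal W=\sum_{k=0}^\infty(\rho_L-\rho_R)^k\,\frac{Q_+^k}{k!}\,\frac{\Gamma(2(S_0^{\mathrm{tot}}+s))}{\Gamma(k+2(S_0^{\mathrm{tot}}+s))}.$$ Then all the infinite sums entering $H'$, $H''$ and $\mathcal W$ converge absolutely; the matrices $H''$, $H^\circ$ and $\mathcal W$ have finitely many nonzero entries in each row; $\mathcal W$ has a two-sided inverse $\mathcal W^{-1}$ among such row-finite matrices; and $$H^\circ=\mathcal W^{-1}H''\,\mathcal W.$$ -/

import Mathlib

open scoped Nat

noncomputable section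

namespace HarmonicChain

/-! ### Infinite matrices indexed by particle configurations

The chain has `N = n + 1 ≥ 1` sites, labelled by `Fin (n + 1)`; the first site is `0` and the last
one is `Fin.last n`. Operators are real infinite matrices in the basis `|m⟩`, with the row index
first: `A p m = ⟨p| A |m⟩`. -/

/-- Configurations: one particle number for each of the `n + 1` sites. -/
abbrev Config (n : ℕ) : Type := Fin (n + 1) → ℕ

/-- Infinite real matrices indexed by configurations. -/
abbrev Op (n : ℕ) : Type := Matrix (Config n) (Config n) ℝ

/-- The configuration `k δ_i`, with `k` particles at site `i` and no other particle. -/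
def pile {n : ℕ} (i : Fin (n + 1)) (k : ℕ) : Config n := Pi.single i k

/-- The basis column vector `|m⟩`, as a function of the row index `p`. -/
def ket {n : ℕ} (m p : Config n) : ℝ := if p = m then 1 else 0

/-- The product of infinite matrices: `(A B)(p, m) = ∑_q A(p, q) B(q, m)`. -/
def Op.mul {n : ℕ} (A B : Op n) : Op n := fun p m => ∑' q, A p q * B q m

infixl:70 " ⊠ " => Op.mul

/-- The product `A B` exists: all the series that define its entries converge absolutely. -/
def Op.MulSummable {n : ℕ} (A B : Op n) : Prop :=
  ∀ p m, Summable fun q => A p q * B q m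

/-- Powers with respect to the product of infinite matrices. -/
def Op.pow {n : ℕ} (A : Op n) : ℕ → Op n
  | 0 => 1
  | k + 1 => A ⊠ Op.pow A k

/-- The exponential series `∑_k A^k / k!`, entry by entry. -/
def Op.exp {n : ℕ} (A : Op n) : Op n := fun p m => ∑' k : ℕ, Op.pow A k p m / (k ! : ℝ)

/-- The exponential of `A` exists: its powers exist, and the exponential series converges absolutely
in every entry. -/
def Op.ExpSummable {n : ℕ} (A : Op n) : Prop :=
  (∀ k, Op.MulSummable A (Op.pow A k)) ∧ ∀ p m, Summable fun k : ℕ => Op.pow A k p m / (k ! : ℝ)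

/-- Every row has finitely many nonzero entries. Products of such matrices are finite sums, and they
form a ring with unit `1`. -/
def Op.RowFinite {n : ℕ} (A : Op n) : Prop := ∀ p, {m | A p m ≠ 0}.Finite

/-- `f(D)` for a function `f` and a diagonal matrix `D`. -/
def Op.diagFun {n : ℕ} (f : ℝ → ℝ) (D : Op n) : Op n := Matrix.diagonal fun m => f (D m m)

/-! ### The `sl(2)` generators of spin `s` -/

/-- `S_+^{[i]} |m⟩ = (m_i + 2 s) |m + δ_i⟩`. -/
def Sp {n : ℕ} (s : ℝ) (i : Fin (n + 1)) : Op n :=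
  fun p m => ((m i : ℝ) + 2 * s) * ket (m + pile i 1) p

/-- `S_-^{[i]} |m⟩ = m_i |m - δ_i⟩` (which is `0` if `m_i = 0`). -/
def Sm {n : ℕ} (i : Fin (n + 1)) : Op n :=
  fun p m => (m i : ℝ) * ket (m - pile i 1) p

/-- `S_0^{[i]} |m⟩ = (m_i + s) |m⟩`. -/
def S0 {n : ℕ} (s : ℝ) (i : Fin (n + 1)) : Op n :=
  fun p m => ((m i : ℝ) + s) * ket m p

/-- The total spin operators `S_a^{tot} = ∑_i S_a^{[i]}`. -/
def SpTot (n : ℕ) (s : ℝ) : Op n := ∑ i, Sp s i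

/-- See `SpTot`. -/
def SmTot (n : ℕ) : Op n := ∑ i, Sm i

/-- See `SpTot`. -/
def S0Tot (n : ℕ) (s : ℝ) : Op n := ∑ i, S0 s i

/-! ### The Hamiltonian of the open harmonic process -/

/-- The jump rates
`φ_s(k, m) = (1 / k) Γ(m + 1) Γ(m - k + 2 s) / (Γ(m - k + 1) Γ(m + 2 s))` for `1 ≤ k ≤ m`. -/
def phi (s : ℝ) (k m : ℕ) : ℝ :=
  if 1 ≤ k ∧ k ≤ m then
    1 / (k : ℝ) * (Real.Gamma ((m : ℝ) + 1) * Real.Gamma ((m : ℝ) - k + 2 * s) /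
      (Real.Gamma ((m : ℝ) - k + 1) * Real.Gamma ((m : ℝ) + 2 * s)))
  else 0

/-- The shifted harmonic numbers `h_s(m) = ∑_{k=1}^m φ_s(k, m)`. -/
def harm (s : ℝ) (m : ℕ) : ℝ := ∑ k ∈ Finset.Icc 1 m, phi s k m

/-- The Hamiltonian density `𝓗_{i,j}` on two sites:
`𝓗_{i,j} |m⟩ = (h_s(m_i) + h_s(m_j)) |m⟩ - ∑_{k=1}^{m_i} φ_s(k, m_i) |m - k δ_i + k δ_j⟩
  - ∑_{k=1}^{m_j} φ_s(k, m_j) |m + k δ_i - k δ_j⟩`. -/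
def bulk {n : ℕ} (s : ℝ) (i j : Fin (n + 1)) : Op n := fun p m =>
  (harm s (m i) + harm s (m j)) * ket m p
    - ∑ k ∈ Finset.Icc 1 (m i), phi s k (m i) * ket (m - pile i k + pile j k) p
    - ∑ k ∈ Finset.Icc 1 (m j), phi s k (m j) * ket (m - pile j k + pile i k) p

/-- `∑_{i=1}^{N-1} 𝓗_{i,i+1}`. -/
def bulkSum (n : ℕ) (s : ℝ) : Op n := ∑ i : Fin n, bulk s i.castSucc i.succ

/-- The boundary term at site `i` for a reservoir with parameter `β`:
`𝓑_i |m⟩ = (h_s(m_i) + ∑_{k ≥ 1} β^k / k) |m⟩ - ∑_{k=1}^{m_i} φ_s(k, m_i) |m - k δ_i⟩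
  - ∑_{k ≥ 1} (β^k / k) |m + k δ_i⟩`.
The series over `k ≥ 1` are indexed by `k - 1`. -/
def bdry {n : ℕ} (s β : ℝ) (i : Fin (n + 1)) : Op n := fun p m =>
  (harm s (m i) + ∑' k : ℕ, β ^ (k + 1) / ((k + 1 : ℕ) : ℝ)) * ket m p
    - ∑ k ∈ Finset.Icc 1 (m i), phi s k (m i) * ket (m - pile i k) p
    - ∑' k : ℕ, β ^ (k + 1) / ((k + 1 : ℕ) : ℝ) * ket (m + pile i (k + 1)) p

/-- The Hamiltonian `H = 𝓑_1 + ∑_{i=1}^{N-1} 𝓗_{i,i+1} + 𝓑_N`; it is minus the transposed generator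
of the open harmonic process. -/
def ham (n : ℕ) (s βL βR : ℝ) : Op n :=
  bdry s βL 0 + bulkSum n s + bdry s βR (Fin.last n)

/-- The density `ρ = β / (1 - β)` of a reservoir with parameter `β`. -/
def dens (β : ℝ) : ℝ := β / (1 - β)

/-- `H' = e^{S_-^{tot}} H e^{-S_-^{tot}}`. -/
def ham' (n : ℕ) (s βL βR : ℝ) : Op n :=
  Op.exp (SmTot n) ⊠ ham n s βL βR ⊠ Op.exp (-SmTot n)

/-- `H'' = e^{-ρ_R S_+^{tot}} H' e^{ρ_R S_+^{tot}}`. -/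
def ham'' (n : ℕ) (s βL βR : ℝ) : Op n :=
  Op.exp (-(dens βR • SpTot n s)) ⊠ ham' n s βL βR ⊠ Op.exp (dens βR • SpTot n s)

/-! ### The Hamiltonian with diagonal boundaries and the non-local transformation -/

/-- The digamma function `ψ = Γ' / Γ` on the reals. -/
def psi (x : ℝ) : ℝ := logDeriv Real.Gamma x

/-- The diagonal boundary term `𝓑_i° = ψ(S_0^{[i]} + s) - ψ(2 s)`. -/
def bdryDiag {n : ℕ} (s : ℝ) (i : Fin (n + 1)) : Op n :=
  Op.diagFun (fun x => psi (x + s) - psi (2 * s)) (S0 s i)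

/-- `H° = 𝓑_1° + ∑_{i=1}^{N-1} 𝓗_{i,i+1} + 𝓑_N°`. -/
def hamDiag (n : ℕ) (s : ℝ) : Op n :=
  bdryDiag s 0 + bulkSum n s + bdryDiag s (Fin.last n)

/-- `Q_+ = s S_+^{tot} + ∑_i S_+^{[i]} (S_0^{[i]} + 2 ∑_{j > i} S_0^{[j]})`. -/
def Qp (n : ℕ) (s : ℝ) : Op n :=
  s • SpTot n s + ∑ i, Sp s i ⊠ (S0 s i + (2 : ℝ) • ∑ j ∈ Finset.Ioi i, S0 s j)

/-- The `k`-th term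
`(ρ_L - ρ_R)^k (Q_+^k / k!) Γ(2 (S_0^{tot} + s)) / Γ(k + 2 (S_0^{tot} + s))` of the series `𝓦`. -/
def WTerm (n : ℕ) (s βL βR : ℝ) (k : ℕ) : Op n :=
  (dens βL - dens βR) ^ k • (((k ! : ℝ)⁻¹ • Op.pow (Qp n s) k) ⊠
    Op.diagFun (fun x => Real.Gamma (2 * (x + s)) / Real.Gamma (k + 2 * (x + s))) (S0Tot n s))

/-- The non-local transformation `𝓦`, the sum of its series entry by entry. -/
def W (n : ℕ) (s βL βR : ℝ) : Op n := fun p m => ∑' k : ℕ, WTerm n s βL βR k p m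

/-- All infinite sums that enter `H'`, `H''` and `𝓦` converge absolutely: the exponentials exist,
so do the matrix products that define `H'`, `H''` and the powers of `Q_+`, and the series of `𝓦`
converges in every entry. -/
structure SeriesConverge (n : ℕ) (s βL βR : ℝ) : Prop where
  exp_Sm : Op.ExpSummable (SmTot n)
  exp_neg_Sm : Op.ExpSummable (-SmTot n)
  exp_Sp : Op.ExpSummable (dens βR • SpTot n s)
  exp_neg_Sp : Op.ExpSummable (-(dens βR • SpTot n s))
  ham'_left : Op.MulSummable (Op.exp (SmTot n)) (ham n s βL βR)
  ham'_right :
    Op.MulSummable (Op.exp (SmTot n) ⊠ ham n s βL βR) (Op.exp (-SmTot n))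
  ham''_left : Op.MulSummable (Op.exp (-(dens βR • SpTot n s))) (ham' n s βL βR)
  ham''_right :
    Op.MulSummable (Op.exp (-(dens βR • SpTot n s)) ⊠ ham' n s βL βR)
      (Op.exp (dens βR • SpTot n s))
  pow_Qp : ∀ k, Op.MulSummable (Qp n s) (Op.pow (Qp n s) k)
  series_W : ∀ p m, Summable fun k : ℕ => WTerm n s βL βR k p m

/-- `V = A⁻¹`: both are row-finite, and `V` is the two-sided inverse of `A` in the ring of row-finite
infinite matrices (hence it is unique). -/
def Op.IsInverse {n : ℕ} (A V : Op n) : Prop :=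
  A.RowFinite ∧ V.RowFinite ∧ A ⊠ V = 1 ∧ V ⊠ A = 1

end HarmonicChain

end

open scoped Nat

noncomputable section

namespace HarmonicChain

/-! ### Column-finite matrices as endomorphisms -/

/-! The proof moves the infinite matrices into an algebra where associativity is free. Column-finite
matrices are endomorphisms of the finitely supported vectors (`EndV`). A matrix whose columns are
infinite, but which only raises the number of particles, is the entrywise sum (`total`) of a power
series over `EndV` whose `k`-th coefficient raises it by exactly `k`. The position of an entry
determines `k`, so `total` is multiplicative on such series (`total_mul`). The exponentials of
`S_+^{tot}`, the matrices `H'`, `H''`, `H°` and the series `𝓦` all become power series. Only `H`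
must be handled analytically.

Write `h_i` for the diagonal operator `h_s(m_i)` and `T_i` for the bare shift `|m⟩ ↦ |m + δ_i⟩`.
From `[h_i, S_+^{tot}] = T_i` and `[S_+^{tot}, T_i] = T_i²` follows `e^{x S_+} h_i e^{-x S_+} = h_i
+ log(1 - x T_i)` (`expSer_mul_C`). Conjugating `𝓑_i` by `e^{S_-^{tot}}` gives exactly this operator
with `x = ρ`; in matrix entries this is a pair of binomial sums (`hasSum_exp_mul_bdry`). The bulk
commutes with `S_±^{tot}`. Conjugation by `e^{-ρ_R S_+}` then shifts both values of `x` by `-ρ_R`,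
so that `H'' = H° + log(1 - (ρ_L - ρ_R) T_1)` (`conj_ham'E`).

Put `c = 2 (S_0^{tot} + s)`. The commutators of the bulk densities with `Q_+` are `S_+^{[i]} -
S_+^{[i+1]}` and telescope; together with the boundary terms they give `[H°, Q_+] = T_1 c`
(`hamDiagE_mul_chargeE`), and also `[Q_+, T_1] = T_1² (c + 1)` (`chargeE_mul_shiftE`). These two
relations determine `[H°, Q_+^k]`. Dividing it by `c (c + 1) ⋯ (c + k - 1)` removes all extra
dependence on `c` and leaves the coefficients of the logarithm, whence `H'' 𝓦 = 𝓦 H°`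
(`logSer_mul_wSer`). Finally `𝓦` has constant coefficient `1`, so it is invertible as a power
series, with a graded inverse. -/

/-- Endomorphisms of the space of finite linear combinations of the basis vectors. -/
abbrev EndV (n : ℕ) : Type := Module.End ℝ (Config n →₀ ℝ)

/-- The basis vector `|m⟩` as a finitely supported function. -/
def vec {n : ℕ} (m : Config n) : Config n →₀ ℝ := Finsupp.single m 1

/-- The endomorphism with prescribed images of the basis vectors. -/
def opOf {n : ℕ} (v : Config n → (Config n →₀ ℝ)) : EndV n := Finsupp.linearCombination ℝ v

@[simp] lemma opOf_vec {n : ℕ} (v : Config n → (Config n →₀ ℝ)) (m : Config n) :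
    opOf v (vec m) = v m := by
  simp [opOf, vec]

lemma endV_ext {n : ℕ} {f g : EndV n} (h : ∀ m, f (vec m) = g (vec m)) : f = g :=
  Finsupp.lhom_ext fun m b => by
    have : Finsupp.single m b = b • vec m := by simp [vec]
    rw [this, map_smul, map_smul, h]

lemma ket_eq {n : ℕ} (m p : Config n) : ket m p = vec m p := by
  simp only [ket, vec, Finsupp.single_apply, eq_comm]

@[simp] lemma vec_self {n : ℕ} (m : Config n) : vec m m = 1 := Finsupp.single_eq_same

lemma vec_of_ne {n : ℕ} {m p : Config n} (h : p ≠ m) : vec m p = 0 :=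
  Finsupp.single_eq_of_ne h

lemma eq_of_vec_ne_zero {n : ℕ} {m p : Config n} (h : vec m p ≠ 0) : p = m := by
  by_contra hne
  exact h (vec_of_ne hne)

/-- The matrix of an endomorphism. -/
def mat {n : ℕ} (f : EndV n) : Op n := fun p m => f (vec m) p

lemma mat_apply {n : ℕ} (f : EndV n) (p m : Config n) : mat f p m = f (vec m) p := rfl

@[simp] lemma mat_zero {n : ℕ} : mat (0 : EndV n) = 0 := rfl

@[simp] lemma mat_add {n : ℕ} (f g : EndV n) : mat (f + g) = mat f + mat g := rfl

@[simp] lemma mat_smul {n : ℕ} (c : ℝ) (f : EndV n) : mat (c • f) = c • mat f := rfl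

@[simp] lemma mat_one {n : ℕ} : mat (1 : EndV n) = 1 := by
  ext p m
  simp [mat, Matrix.one_apply, ← ket_eq, ket]

lemma mat_sum {n : ℕ} {ι : Type*} (t : Finset ι) (f : ι → EndV n) :
    mat (∑ i ∈ t, f i) = ∑ i ∈ t, mat (f i) := by
  ext p m
  simp [mat, Matrix.sum_apply]

lemma apply_eq_sum {n : ℕ} (f : EndV n) (v : Config n →₀ ℝ) (p : Config n) :
    f v p = ∑ q ∈ v.support, f (vec q) p * v q := by
  conv_lhs => rw [← Finsupp.sum_single v]
  rw [Finsupp.sum, map_sum, Finsupp.finsetSum_apply]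
  refine Finset.sum_congr rfl fun q _ => ?_
  have : Finsupp.single q (v q) = v q • vec q := by simp [vec]
  rw [this, map_smul, Finsupp.smul_apply, smul_eq_mul, mul_comm]

/-- A column of `mat g` has finite support, so nothing is required of `A`. -/
lemma mulSummable_mat {n : ℕ} (A : Op n) (g : EndV n) : Op.MulSummable A (mat g) := by
  intro p m
  refine summable_of_ne_finset_zero (s := (g (vec m)).support) fun q hq => ?_
  simp [mat, Finsupp.notMem_support_iff.1 hq]

lemma mat_mul {n : ℕ} (f g : EndV n) : mat (f * g) = mat f ⊠ mat g := by
  ext p m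
  rw [Op.mul, tsum_eq_sum (s := (g (vec m)).support) fun q hq => ?_]
  · exact apply_eq_sum f (g (vec m)) p
  · simp [mat, Finsupp.notMem_support_iff.1 hq]

lemma pow_mat {n : ℕ} (f : EndV n) (k : ℕ) : Op.pow (mat f) k = mat (f ^ k) := by
  induction k with
  | zero => simp [Op.pow]
  | succ k ih => rw [Op.pow, ih, ← mat_mul, pow_succ']

/-! ### The grading by the total number of particles -/

/-- The total number of particles. -/
def size {n : ℕ} (m : Config n) : ℕ := ∑ i, m i

lemma finite_size_le {n : ℕ} (K : ℕ) : {q : Config n | size q ≤ K}.Finite := by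
  refine (Set.finite_Iic (fun _ : Fin (n + 1) => K)).subset fun q hq i => ?_
  exact (Finset.single_le_sum (f := q) (fun _ _ => Nat.zero_le _) (Finset.mem_univ i)).trans hq

/-- The endomorphism raises the total number of particles by `d`. -/
def HasDeg {n : ℕ} (d : ℤ) (f : EndV n) : Prop :=
  ∀ m p, f (vec m) p ≠ 0 → (size p : ℤ) = size m + d

namespace HasDeg

variable {n : ℕ} {d d' : ℤ} {f g : EndV n}

lemma zero : HasDeg d (0 : EndV n) := fun _ _ h => absurd rfl h

lemma add (hf : HasDeg d f) (hg : HasDeg d g) : HasDeg d (f + g) := by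
  intro m p h
  by_cases h1 : f (vec m) p = 0
  · exact hg m p fun h2 => h (by simp [h1, h2])
  · exact hf m p h1

lemma smul (c : ℝ) (hf : HasDeg d f) : HasDeg d (c • f) := by
  intro m p h
  exact hf m p fun h2 => h (by simp [h2])

lemma neg (hf : HasDeg d f) : HasDeg d (-f) := by
  intro m p h
  exact hf m p fun h2 => h (by simp [h2])

lemma sub (hf : HasDeg d f) (hg : HasDeg d g) : HasDeg d (f - g) := by
  intro m p h
  by_cases h1 : f (vec m) p = 0
  · exact hg m p fun h2 => h (by simp [h1, h2])
  · exact hf m p h1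

lemma sum {ι : Type*} {t : Finset ι} {f : ι → EndV n} (hf : ∀ i ∈ t, HasDeg d (f i)) :
    HasDeg d (∑ i ∈ t, f i) := by
  classical
  induction t using Finset.induction_on with
  | empty => simpa using zero
  | insert a t ha ih =>
    rw [Finset.sum_insert ha]
    exact (hf _ (by simp)).add (ih fun i hi => hf i (by simp [hi]))

lemma mul (hf : HasDeg d f) (hg : HasDeg d' g) : HasDeg (d + d') (f * g) := by
  intro m p h
  rw [Module.End.mul_apply, apply_eq_sum] at h
  obtain ⟨q, -, hq⟩ := Finset.exists_ne_zero_of_sum_ne_zero h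
  have h1 := hf q p (left_ne_zero_of_mul hq)
  have h2 := hg m q (right_ne_zero_of_mul hq)
  omega

lemma one : HasDeg 0 (1 : EndV n) := by
  intro m p h
  simp [eq_of_vec_ne_zero h]

lemma pow (hf : HasDeg d f) (k : ℕ) : HasDeg (d * k) (f ^ k) := by
  induction k with
  | zero => simpa using one
  | succ k ih =>
    rw [pow_succ]
    have := ih.mul hf
    push_cast
    rwa [mul_add, mul_one]

end HasDeg

/-! ### Graded power series and their entrywise sums -/

/-- A power series of endomorphisms whose `k`-th coefficient has degree `ε k`. -/
def Graded {n : ℕ} (ε : ℤ) (F : PowerSeries (EndV n)) : Prop :=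
  ∀ k : ℕ, HasDeg (ε * k) (PowerSeries.coeff k F)

namespace Graded

variable {n : ℕ} {ε : ℤ} {F G : PowerSeries (EndV n)}

lemma add (hF : Graded ε F) (hG : Graded ε G) : Graded ε (F + G) := by
  intro k
  rw [map_add]
  exact (hF k).add (hG k)

lemma mul (hF : Graded ε F) (hG : Graded ε G) : Graded ε (F * G) := by
  intro k
  rw [PowerSeries.coeff_mul]
  refine HasDeg.sum fun x hx => ?_
  have : ε * k = ε * x.1 + ε * x.2 := by
    rw [← Finset.HasAntidiagonal.mem_antidiagonal.1 hx]; push_cast; ring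
  rw [this]
  exact (hF _).mul (hG _)

lemma C {f : EndV n} (hf : HasDeg 0 f) : Graded ε (PowerSeries.C f) := by
  intro k
  rw [PowerSeries.coeff_C]
  split_ifs with h
  · simpa [h] using hf
  · exact HasDeg.zero

/-- Strong induction along the recursion for the coefficients of an inverse series. This makes the
inverse of `𝓦` again the matrix of a graded series, hence row-finite. -/
lemma invOfUnit_one (hF : Graded ε F) : Graded ε (F.invOfUnit 1) := by
  intro k
  induction k using Nat.strong_induction_on with
  | _ k ih =>
    have key : PowerSeries.coeff k (F.invOfUnit 1) =
        if k = 0 then (((1 : (EndV n)ˣ)⁻¹ : (EndV n)ˣ) : EndV n)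
        else -(((1 : (EndV n)ˣ)⁻¹ : (EndV n)ˣ) : EndV n) *
          ∑ x ∈ Finset.HasAntidiagonal.antidiagonal k,
          if x.2 < k then PowerSeries.coeff x.1 F * PowerSeries.coeff x.2 (F.invOfUnit 1)
          else 0 := PowerSeries.coeff_invOfUnit k F 1
    rw [key]
    split_ifs with h
    · simpa [h] using HasDeg.one
    · simp only [inv_one, Units.val_one]
      refine HasDeg.neg (HasDeg.sum fun x hx => ?_)
      split_ifs with hx2
      · have : ε * k = ε * x.1 + ε * x.2 := by
          rw [← Finset.HasAntidiagonal.mem_antidiagonal.1 hx]; push_cast; ring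
        rw [this]
        exact (hF _).mul (ih _ hx2)
      · exact HasDeg.zero

end Graded

/-- The matrix obtained by summing up, entry by entry, the coefficients of a power series. -/
def total {n : ℕ} (F : PowerSeries (EndV n)) : Op n :=
  fun p m => ∑' k, mat (PowerSeries.coeff k F) p m

section Total

variable {n : ℕ} {ε : ℤ} {F G : PowerSeries (EndV n)}

/-- For `ε ≠ 0` the sizes of `p` and `m` determine the degree, so each entry of `total F` comes from
at most one coefficient. -/
lemma Graded.mat_eq_zero (hε : ε ≠ 0) (hF : Graded ε F) {p m : Config n} {k j : ℕ}
    (h : (size p : ℤ) = size m + ε * k) (hj : j ≠ k) : mat (PowerSeries.coeff j F) p m = 0 := by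
  by_contra hne
  have h1 := hF j m p hne
  have : ε * (j : ℤ) = ε * k := by omega
  exact hj (by exact_mod_cast mul_left_cancel₀ hε this)

lemma total_apply (hε : ε ≠ 0) (hF : Graded ε F) {p m : Config n} {k : ℕ}
    (h : (size p : ℤ) = size m + ε * k) : total F p m = mat (PowerSeries.coeff k F) p m :=
  tsum_eq_single k fun _ hj => hF.mat_eq_zero hε h hj

lemma exists_of_total_ne_zero (hF : Graded ε F) {p m : Config n} (h : total F p m ≠ 0) :
    ∃ k : ℕ, (size p : ℤ) = size m + ε * k := by
  by_contra! hne
  refine h ?_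
  have : ∀ k, mat (PowerSeries.coeff k F) p m = 0 := fun k => by
    by_contra h0
    exact hne k (hF k m p h0)
  simp [total, this]

lemma summable_total (hε : ε ≠ 0) (hF : Graded ε F) (p m : Config n) :
    Summable fun k => mat (PowerSeries.coeff k F) p m := by
  by_cases h : ∃ k : ℕ, (size p : ℤ) = size m + ε * k
  · obtain ⟨k, hk⟩ := h
    exact summable_of_ne_finset_zero (s := {k}) fun j hj =>
      hF.mat_eq_zero hε hk (by simpa using hj)
  · push Not at h
    have : ∀ k, mat (PowerSeries.coeff k F) p m = 0 := fun k => by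
      by_contra h0
      exact h k (hF k m p h0)
    simp [this, summable_zero]

lemma size_le_of_total_ne_zero (hF : Graded ε F) (hε : 0 ≤ ε) {p m : Config n}
    (h : total F p m ≠ 0) : size m ≤ size p := by
  obtain ⟨k, hk⟩ := exists_of_total_ne_zero hF h
  have : 0 ≤ ε * (k : ℤ) := by positivity
  omega

lemma le_size_of_total_ne_zero (hF : Graded ε F) (hε : ε ≤ 0) {p m : Config n}
    (h : total F p m ≠ 0) : size p ≤ size m := by
  obtain ⟨k, hk⟩ := exists_of_total_ne_zero hF h
  have : ε * (k : ℤ) ≤ 0 := mul_nonpos_of_nonpos_of_nonneg hε (by positivity)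
  omega

lemma total_rowFinite (hF : Graded ε F) (hε : 0 ≤ ε) : (total F).RowFinite := fun p =>
  (finite_size_le (size p)).subset fun _ hm => size_le_of_total_ne_zero hF hε hm

/-- For `ε ≥ 0` the rows of the left factor are finite; for `ε ≤ 0` the columns of the right factor
are. -/
lemma mulSummable_total (hF : Graded ε F) (hG : Graded ε G) :
    Op.MulSummable (total F) (total G) := by
  intro p m
  refine summable_of_hasFiniteSupport
    ((finite_size_le (max (size p) (size m))).subset fun q hq => ?_)
  have hq1 := left_ne_zero_of_mul (Function.mem_support.1 hq)
  have hq2 := right_ne_zero_of_mul (Function.mem_support.1 hq)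
  rcases le_total 0 ε with hε | hε
  · exact le_max_of_le_left (size_le_of_total_ne_zero hF hε hq1)
  · exact le_max_of_le_right (le_size_of_total_ne_zero hG hε hq2)

/-- The entry fixes the total degree `k`, and the intermediate configuration `q` fixes how `k`
splits between the two factors. The sum over `q` is therefore the Cauchy product, and matrix
identities reduce to identities of power series. -/
lemma total_mul (hε : ε ≠ 0) (hF : Graded ε F) (hG : Graded ε G) :
    total (F * G) = total F ⊠ total G := by
  ext p m
  by_cases h : ∃ k : ℕ, (size p : ℤ) = size m + ε * k
  · obtain ⟨k, hk⟩ := h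
    rw [total_apply hε (hF.mul hG) hk, PowerSeries.coeff_mul, mat_sum, Matrix.sum_apply]
    simp only [mat_mul, Op.mul]
    rw [← Summable.tsum_finsetSum fun x _ => mulSummable_mat _ _ p m]
    refine tsum_congr fun q => ?_
    -- If `q` lies at level `j ≤ k`, only the pair `(k - j, j)` contributes; at any other level both
    -- sides vanish.
    by_cases hq : ∃ j : ℕ, j ≤ k ∧ (size q : ℤ) = size m + ε * j
    · obtain ⟨j, hjk, hj⟩ := hq
      have hi : (size p : ℤ) = size q + ε * ((k - j : ℕ) : ℤ) := by
        rw [hk, hj]; push_cast [hjk]; ring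
      rw [total_apply hε hF hi, total_apply hε hG hj, Finset.sum_eq_single (k - j, j)]
      · rintro ⟨i', j'⟩ hx hne
        have hx' := Finset.HasAntidiagonal.mem_antidiagonal.1 hx
        have : j' ≠ j := by
          rintro rfl
          exact hne (by simp only [Prod.mk.injEq, and_true]; simp at hx'; omega)
        rw [hG.mat_eq_zero hε hj this, mul_zero]
      · intro hx
        exact absurd (Finset.HasAntidiagonal.mem_antidiagonal.2 (by simp; omega)) hx
    · push Not at hq
      rw [Finset.sum_eq_zero]
      · by_contra hne
        obtain ⟨i, hi⟩ := exists_of_total_ne_zero hF (left_ne_zero_of_mul (Ne.symm hne))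
        obtain ⟨j, hj⟩ := exists_of_total_ne_zero hG (right_ne_zero_of_mul (Ne.symm hne))
        have : ε * (k : ℤ) = ε * ((i + j : ℕ) : ℤ) := by push_cast; rw [mul_add]; omega
        have := mul_left_cancel₀ hε this
        exact hq j (by omega) hj
      · rintro ⟨i, j⟩ hx
        have hx' := Finset.HasAntidiagonal.mem_antidiagonal.1 hx
        by_contra hne
        exact hq j (by simp at hx'; omega) (hG j m q (right_ne_zero_of_mul hne))
  · have h0 : total (F * G) p m = 0 := by
      by_contra hne
      exact h (exists_of_total_ne_zero (hF.mul hG) hne)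
    rw [h0, Op.mul, eq_comm]
    have : ∀ q, total F p q * total G q m = 0 := fun q => by
      by_contra hne
      obtain ⟨i, hi⟩ := exists_of_total_ne_zero hF (left_ne_zero_of_mul hne)
      obtain ⟨j, hj⟩ := exists_of_total_ne_zero hG (right_ne_zero_of_mul hne)
      exact h ⟨i + j, by push_cast; rw [mul_add]; omega⟩
    simp [this]

lemma total_C (f : EndV n) : total (PowerSeries.C f) = mat f := by
  ext p m
  rw [total, tsum_eq_single 0]
  · simp
  · intro k hk
    simp [PowerSeries.coeff_C, hk]

lemma total_one : total (1 : PowerSeries (EndV n)) = 1 := by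
  rw [← map_one PowerSeries.C, total_C, mat_one]

lemma total_add (hε : ε ≠ 0) (hF : Graded ε F) (hG : Graded ε G) :
    total (F + G) = total F + total G := by
  ext p m
  simp only [total, Matrix.add_apply, map_add, mat_add]
  exact (summable_total hε hF p m).tsum_add (summable_total hε hG p m)

end Total

/-! ### Formal exponentials -/

/-- The series `∑_k (x^k / k!) A^k X^k`. -/
def expSer {R : Type*} [Semiring R] [Algebra ℝ R] (x : ℝ) (A : R) : PowerSeries R :=
  PowerSeries.mk fun k => (x ^ k / (k ! : ℝ)) • A ^ k

section Exp

variable {R : Type*} [Semiring R] [Algebra ℝ R] {A : R}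

lemma expSer_mul_expSer (x y : ℝ) (A : R) :
    expSer x A * expSer y A = expSer (x + y) A := by
  ext1 k
  rw [PowerSeries.coeff_mul]
  simp only [expSer, PowerSeries.coeff_mk]
  rw [(Commute.all x y).add_pow', Finset.sum_div, Finset.sum_smul]
  refine Finset.sum_congr rfl fun z hz => ?_
  have hz' := Finset.HasAntidiagonal.mem_antidiagonal.1 hz
  rw [smul_mul_smul_comm, ← pow_add, hz']
  congr 1
  have h1 := Nat.add_choose_mul_factorial_mul_factorial z.1 z.2
  rw [hz'] at h1
  have h2 : ((k.choose z.1 : ℕ) : ℝ) * (z.1 ! : ℝ) * (z.2 ! : ℝ) = (k ! : ℝ) := by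
    rw [← h1, ← hz', Nat.choose_symm_add]; push_cast; ring
  have := Nat.factorial_ne_zero z.1
  have := Nat.factorial_ne_zero z.2
  have := Nat.factorial_ne_zero k
  rw [nsmul_eq_mul]
  field_simp
  rw [← h2]; ring

lemma expSer_zero : expSer 0 A = 1 := by
  ext1 k
  rw [expSer, PowerSeries.coeff_mk, PowerSeries.coeff_one]
  split_ifs with h
  · simp [h]
  · simp [h]

lemma expSer_mul_C_of_commute {B : R} (h : Commute A B) (x : ℝ) :
    expSer x A * PowerSeries.C B = PowerSeries.C B * expSer x A := by
  ext1 k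
  rw [PowerSeries.coeff_mul_C, PowerSeries.coeff_C_mul, expSer, PowerSeries.coeff_mk,
    smul_mul_assoc, mul_smul_comm, (h.pow_left k).eq]

end Exp

section Exp

variable {n : ℕ} {ε : ℤ} {A : EndV n}

lemma graded_expSer (hA : HasDeg ε A) (x : ℝ) : Graded ε (expSer x A) := fun k => by
  rw [expSer, PowerSeries.coeff_mk]
  exact (hA.pow k).smul _

lemma pow_smul_mat_div (x : ℝ) (A : EndV n) (k : ℕ) (p m : Config n) :
    Op.pow (x • mat A) k p m / (k ! : ℝ) = mat (PowerSeries.coeff k (expSer x A)) p m := by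
  rw [← mat_smul, pow_mat, smul_pow, expSer, PowerSeries.coeff_mk, mat_smul, mat_smul,
    Matrix.smul_apply, Matrix.smul_apply, smul_eq_mul, smul_eq_mul]
  ring

lemma exp_smul_mat (x : ℝ) (A : EndV n) : Op.exp (x • mat A) = total (expSer x A) := by
  ext p m
  exact tsum_congr fun k => pow_smul_mat_div x A k p m

lemma expSummable_smul_mat (hε : ε ≠ 0) (hA : HasDeg ε A) (x : ℝ) :
    Op.ExpSummable (x • mat A) := by
  refine ⟨fun k => ?_, fun p m => ?_⟩
  · rw [← mat_smul, pow_mat]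
    exact mulSummable_mat _ _
  · simp only [pow_smul_mat_div]
    exact summable_total hε (graded_expSer hA x) p m

end Exp

/-! ### Associativity -/

/-- Infinite matrices do not multiply associatively in general. Finite rows on the left and finite
columns on the right turn the double series into a finite double sum, whatever `B` is. -/
lemma mul_assoc_of_finite {n : ℕ} {A B C : Op n} (hA : A.RowFinite)
    (hC : ∀ m, {q | C q m ≠ 0}.Finite) : A ⊠ B ⊠ C = A ⊠ (B ⊠ C) := by
  ext p m
  have h1 : ∀ r, (A ⊠ B) p r = ∑ q ∈ (hA p).toFinset, A p q * B q r := fun r =>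
    tsum_eq_sum fun q hq => by
      have : A p q = 0 := by simpa using hq
      simp [this]
  have h2 : ∀ q, (B ⊠ C) q m = ∑ r ∈ (hC m).toFinset, B q r * C r m := fun q =>
    tsum_eq_sum fun r hr => by
      have : C r m = 0 := by simpa using hr
      simp [this]
  have h3 : (A ⊠ B ⊠ C) p m = ∑ r ∈ (hC m).toFinset, (A ⊠ B) p r * C r m :=
    tsum_eq_sum fun r hr => by
      have : C r m = 0 := by simpa using hr
      simp [this]
  have h4 : (A ⊠ (B ⊠ C)) p m = ∑ q ∈ (hA p).toFinset, A p q * (B ⊠ C) q m :=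
    tsum_eq_sum fun q hq => by
      have : A p q = 0 := by simpa using hq
      simp [this]
  rw [h3, h4]
  simp only [h1, h2, Finset.sum_mul, Finset.mul_sum]
  rw [Finset.sum_comm]
  simp only [mul_assoc]

/-! ### Rising factorials and ratios of Gamma values -/

/-- The rising factorial `x (x + 1) ⋯ (x + k - 1)`. -/
def rising (x : ℝ) (k : ℕ) : ℝ := ∏ i ∈ Finset.range k, (x + i)

lemma rising_zero (x : ℝ) : rising x 0 = 1 := by simp [rising]

lemma rising_succ (x : ℝ) (k : ℕ) : rising x (k + 1) = rising x k * (x + k) :=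
  Finset.prod_range_succ _ _

lemma rising_succ' (x : ℝ) (k : ℕ) : rising x (k + 1) = x * rising (x + 1) k := by
  rw [rising, Finset.prod_range_succ', rising, mul_comm]
  congr 1
  · simp
  · refine Finset.prod_congr rfl fun i _ => ?_
    push_cast; ring

lemma rising_add (x : ℝ) (i j : ℕ) : rising x (i + j) = rising x i * rising (x + i) j := by
  rw [rising, Finset.prod_range_add, rising, rising]
  congr 1
  refine Finset.prod_congr rfl fun i _ => ?_
  push_cast; ring

lemma rising_pos {x : ℝ} (hx : 0 < x) (k : ℕ) : 0 < rising x k :=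
  Finset.prod_pos fun _ _ => by positivity

lemma Gamma_add_nat {x : ℝ} (hx : 0 < x) (k : ℕ) :
    Real.Gamma (x + k) = rising x k * Real.Gamma x := by
  induction k with
  | zero => simp [rising_zero]
  | succ k ih =>
    have : x + (k : ℝ) ≠ 0 := by positivity
    rw [Nat.cast_succ, ← add_assoc, Real.Gamma_add_one this, ih, rising_succ]
    ring

/-! ### Conjugating an operator by an exponential into a logarithm -/

section Conjugation

variable {R : Type*} [Semiring R] [Algebra ℝ R]

/-- The series `B - ∑_{k ≥ 1} (x^k / k) T^k X^k`. -/
def logSer (x : ℝ) (B T : R) : PowerSeries R :=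
  PowerSeries.mk fun k => if k = 0 then B else (-(x ^ k / (k : ℝ))) • T ^ k

lemma mul_pow_of_mul_eq {S T : R} (h : S * T = T * S + T ^ 2) (k : ℕ) :
    S * T ^ k = T ^ k * S + (k : ℝ) • T ^ (k + 1) := by
  induction k with
  | zero => simp
  | succ k ih =>
    rw [pow_succ, ← mul_assoc, ih, add_mul, mul_assoc, h, mul_add, smul_mul_assoc, ← pow_succ,
      ← mul_assoc, ← pow_succ, ← pow_add, Nat.cast_succ, add_smul, one_smul, add_assoc]
    congr 1
    rw [add_comm]

/-- The hypothesis says that `g k` is the iterated commutator `ad_S^k (g 0) / k!`, so this is `e^S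
(g 0) = (∑ g k) e^S` in degree `k`, free of subtraction. -/
lemma pow_mul_eq_sum_antidiagonal {S : R} {g : ℕ → R}
    (h : ∀ k, S * g k = g k * S + ((k : ℝ) + 1) • g (k + 1)) (k : ℕ) :
    ((k ! : ℝ)⁻¹) • (S ^ k * g 0) =
      ∑ z ∈ Finset.HasAntidiagonal.antidiagonal k, g z.1 * ((z.2 ! : ℝ)⁻¹ • S ^ z.2) := by
  induction k with
  | zero => simp
  | succ k ih =>
    have hk : ((k : ℝ) + 1) ≠ 0 := by positivity
    have e1 : (((k + 1) ! : ℕ) : ℝ)⁻¹ • (S ^ (k + 1) * g 0) =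
        ((k : ℝ) + 1)⁻¹ • (S * ((k ! : ℝ)⁻¹ • (S ^ k * g 0))) := by
      rw [mul_smul_comm, smul_smul, ← mul_assoc, ← pow_succ', Nat.factorial_succ]
      push_cast
      rw [mul_inv]
    have e2 : ∀ z : ℕ × ℕ, S * (g z.1 * ((z.2 ! : ℝ)⁻¹ • S ^ z.2)) =
        (((z.2 + 1 : ℕ) : ℝ)) • (g z.1 * ((((z.2 + 1) ! : ℕ) : ℝ)⁻¹ • S ^ (z.2 + 1))) +
        (((z.1 + 1 : ℕ) : ℝ)) • (g (z.1 + 1) * ((z.2 ! : ℝ)⁻¹ • S ^ z.2)) := by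
      intro z
      rw [← mul_assoc, h, add_mul, smul_mul_assoc]
      congr 1
      · have : ((z.2 : ℝ) + 1) ≠ 0 := by positivity
        rw [mul_smul_comm, mul_smul_comm, smul_smul, mul_assoc, ← pow_succ', Nat.factorial_succ]
        congr 1
        push_cast
        field_simp
      · push_cast; rfl
    -- Both sums are extended to the antidiagonal of `k + 1`, the added terms having weight `0`. The
    -- weights `z.2` and `z.1` then add up to `k + 1`.
    have e3 := Finset.Nat.sum_antidiagonal_succ' (n := k)
      (f := fun z : ℕ × ℕ => (z.2 : ℝ) • (g z.1 * ((z.2 ! : ℝ)⁻¹ • S ^ z.2)))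
    have e4 := Finset.Nat.sum_antidiagonal_succ (n := k)
      (f := fun z : ℕ × ℕ => (z.1 : ℝ) • (g z.1 * ((z.2 ! : ℝ)⁻¹ • S ^ z.2)))
    simp only [Nat.cast_zero, zero_smul, zero_add] at e3 e4
    rw [e1, ih, Finset.mul_sum, Finset.sum_congr rfl fun z _ => e2 z, Finset.sum_add_distrib,
      ← e3, ← e4, ← Finset.sum_add_distrib, Finset.smul_sum]
    refine Finset.sum_congr rfl fun z hz => ?_
    have hz' : (z.2 : ℝ) + z.1 = k + 1 := by
      have := Finset.HasAntidiagonal.mem_antidiagonal.1 hz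
      have h2 : ((z.1 + z.2 : ℕ) : ℝ) = ((k + 1 : ℕ) : ℝ) := by rw [this]
      push_cast at h2
      linarith
    rw [← add_smul, smul_smul, hz', inv_mul_cancel₀ hk, one_smul]

/-- The commutators are `ad_S B = -T` and `ad_S T = T²`, hence `ad_S^k B / k! = -T^k / k`: formally,
`e^{xS} B e^{-xS} = B + log(1 - x T)`. -/
lemma expSer_mul_C {S B T : R} (hB : B * S = S * B + T) (hT : S * T = T * S + T ^ 2) (x : ℝ) :
    expSer x S * PowerSeries.C B = logSer x B T * expSer x S := by
  set g : ℕ → R := fun k => if k = 0 then B else (-(1 / (k : ℝ))) • T ^ k with hg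
  have hgS : ∀ k, S * g k = g k * S + ((k : ℝ) + 1) • g (k + 1) := by
    intro k
    rcases k with _ | k
    · simp only [hg, ↓reduceIte, hB, Nat.cast_zero, zero_add, one_smul, Nat.cast_one, div_one,
        one_ne_zero, pow_one, add_assoc]
      -- `R` is only a semiring, so `-T` is available only as a scalar multiple.
      have : T + (-1 : ℝ) • T = 0 := by
        rw [← one_smul ℝ T, smul_smul, ← add_smul]; norm_num
      rw [this, add_zero]
    · have h1 : ((k : ℝ) + 1) ≠ 0 := by positivity
      have h2 : ((k : ℝ) + 1 + 1) ≠ 0 := by positivity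
      simp only [hg, Nat.add_eq_zero_iff, one_ne_zero, and_false, ↓reduceIte, mul_smul_comm,
        smul_mul_assoc, mul_pow_of_mul_eq hT, smul_add, smul_smul]
      congr 2
      push_cast
      field_simp
  ext1 k
  rw [PowerSeries.coeff_mul_C, PowerSeries.coeff_mul]
  simp only [expSer, logSer, PowerSeries.coeff_mk]
  have key := congrArg (fun y => x ^ k • y) (pow_mul_eq_sum_antidiagonal hgS k)
  simp only [Finset.smul_sum, smul_smul] at key
  rw [smul_mul_assoc, div_eq_mul_inv]
  refine Eq.trans ?_ (key.trans (Finset.sum_congr rfl fun z hz => ?_))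
  · simp [hg]
  · rw [← Finset.HasAntidiagonal.mem_antidiagonal.1 hz, pow_add]
    simp only [hg, div_eq_mul_inv]
    split_ifs with h0
    · simp only [h0, mul_smul_comm, smul_smul, pow_zero, one_mul]
    · simp only [mul_smul_comm, smul_mul_assoc, smul_smul]
      congr 1
      ring

end Conjugation

/-! ### The intertwining relation from the commutators of `H`, `Q` and `T` -/

section Intertwining

variable {R : Type*} [Semiring R] [Algebra ℝ R] {H Q T : R} {D : (ℝ → ℝ) →ₐ[ℝ] R}

/-- Each further factor `T` adds `c + 1` and shifts the previous coefficient by `c ↦ c + 2`; indeed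
`(c + 1) + j (c + 2 + j) = (j + 1) (c + j + 1)`. -/
lemma mul_pow_of_quadratic (hDT : ∀ f, D f * T = T * D fun c => f (c + 2))
    (hQT : Q * T = T * Q + T ^ 2 * D fun c => c + 1) (j : ℕ) :
    Q * T ^ j = T ^ j * Q + T ^ (j + 1) * D fun c => j * (c + j) := by
  induction j with
  | zero =>
    have : (fun c : ℝ => ((0 : ℕ) : ℝ) * (c + (0 : ℕ))) = 0 := by ext; simp
    rw [this]; simp
  | succ j ih =>
    have e : (fun c : ℝ => ((j + 1 : ℕ) : ℝ) * (c + (j + 1 : ℕ))) =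
        (fun c : ℝ => c + 1) + fun c : ℝ => (j : ℝ) * (c + 2 + j) := by
      ext c; simp only [Pi.add_apply]; push_cast; ring
    rw [e, map_add, pow_succ, ← mul_assoc, ih, add_mul, mul_assoc, hQT, mul_assoc, hDT, mul_add,
      mul_add, ← mul_assoc, ← mul_assoc, ← mul_assoc, ← pow_succ, ← pow_succ, ← pow_add, add_assoc]

lemma map_mul_pow (hDQ : ∀ f, D f * Q = Q * D fun c => f (c + 2)) (f : ℝ → ℝ) (k : ℕ) :
    D f * Q ^ k = Q ^ k * D fun c => f (c + 2 * k) := by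
  induction k generalizing f with
  | zero => simp
  | succ k ih =>
    rw [pow_succ', ← mul_assoc, hDQ, mul_assoc, ih, ← mul_assoc]
    congr 3
    ext c
    congr 1
    push_cast; ring

/-- The coefficients in the commutator of `H` with a power of `Q`. -/
def commCoeff (k l : ℕ) (c : ℝ) : ℝ :=
  (k.choose (l + 1) : ℝ) * (l ! : ℝ) * rising (c + k - l - 1) (l + 1)

/-- Pascal's rule for `k`, combined with the two ways of splitting one factor off the rising
factorial. The increment is what one more commutation with `Q` produces below. -/
lemma commCoeff_succ (k l : ℕ) (c : ℝ) :
    commCoeff (k + 1) l c = commCoeff k l c +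
      (k.choose l : ℝ) * (l ! : ℝ) * (c + 2 * k - l) * rising (c + k - l) l := by
  unfold commCoeff
  have e1 : c + ((k + 1 : ℕ) : ℝ) - l - 1 = c + k - l := by push_cast; ring
  have e2 : c + (k : ℝ) - l - 1 + 1 = c + k - l := by ring
  rw [e1, rising_succ, rising_succ' (c + k - l - 1), e2, Nat.choose_succ_succ]
  have h : ((k.choose (l + 1) : ℝ)) * (l + 1) = k.choose l * (k - l) := by
    rcases le_total l k with hlk | hlk
    · have := Nat.choose_succ_right_eq k l
      have h2 : ((k.choose (l + 1) * (l + 1) : ℕ) : ℝ) = ((k.choose l * (k - l) : ℕ) : ℝ) := by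
        rw [this]
      push_cast [hlk] at h2
      exact h2
    · rcases hlk.eq_or_lt with rfl | hlt
      · simp
      · simp [Nat.choose_eq_zero_of_lt hlt, Nat.choose_eq_zero_of_lt (Nat.lt_succ_of_lt hlt)]
  push_cast
  linear_combination (l ! : ℝ) * rising (c + k - l) l * h

/-- Start from `H Q^(k+1) = (Q H + T c) Q^k` and expand `H Q^k` by induction. Moving `Q` past
`T^(l+1)` keeps a term of index `l` and creates one of index `l + 1`; the term `T c Q^k` supplies
the new contribution at index `0`. -/
lemma mul_pow_eq_add_sum (hDT : ∀ f, D f * T = T * D fun c => f (c + 2))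
    (hDQ : ∀ f, D f * Q = Q * D fun c => f (c + 2))
    (hQT : Q * T = T * Q + T ^ 2 * D fun c => c + 1)
    (hHQ : H * Q = Q * H + T * D fun c => c) (k : ℕ) :
    H * Q ^ k = Q ^ k * H +
      ∑ l ∈ Finset.range k, T ^ (l + 1) * Q ^ (k - 1 - l) * D (commCoeff k l) := by
  induction k with
  | zero => simp
  | succ k ih =>
    set b : ℕ → ℝ → ℝ := fun l c =>
      (k.choose l : ℝ) * (l ! : ℝ) * (c + 2 * k - l) * rising (c + k - l) l with hb
    have e : ∀ l, commCoeff (k + 1) l = commCoeff k l + b l := fun l => by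
      ext c; exact commCoeff_succ k l c
    -- The top index `l = k` receives only the increment, because `k.choose (k + 1) = 0`.
    have hlast : commCoeff k k = 0 := by ext c; simp [commCoeff]
    have step : ∀ l ∈ Finset.range k, Q * (T ^ (l + 1) * Q ^ (k - 1 - l) * D (commCoeff k l)) =
        T ^ (l + 1) * Q ^ (k - l) * D (commCoeff k l) +
        T ^ (l + 1 + 1) * Q ^ (k - (l + 1)) * D (b (l + 1)) := by
      intro l hl
      have hl' := Finset.mem_range.1 hl
      have hk1 : k - l = (k - 1 - l) + 1 := by omega
      have hk2 : k - (l + 1) = k - 1 - l := by omega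
      rw [hk1, hk2, ← mul_assoc, ← mul_assoc, mul_pow_of_quadratic hDT hQT, add_mul, add_mul,
        pow_succ' Q, mul_assoc (T ^ (l + 1)) Q, mul_assoc (T ^ (l + 1 + 1)) _ (Q ^ _),
        map_mul_pow hDQ, mul_assoc (T ^ (l + 1 + 1)), mul_assoc (Q ^ _), ← map_mul,
        mul_assoc (T ^ (l + 1 + 1))]
      congr 4
      ext c
      simp only [Pi.mul_apply, hb, commCoeff]
      have : ((k - 1 - l : ℕ) : ℝ) = k - 1 - l := by
        rw [Nat.cast_sub (by omega), Nat.cast_sub (by omega)]; simp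
      rw [this, Nat.factorial_succ]
      have e5 : c + (k : ℝ) - ((l + 1 : ℕ) : ℝ) = c + k - l - 1 := by push_cast; ring
      rw [e5]
      push_cast
      ring
    have hb0 : b 0 = fun c => c + 2 * (k : ℝ) := by
      ext c; simp [hb, rising_zero]
    rw [pow_succ', ← mul_assoc, hHQ, add_mul, mul_assoc, ih, mul_add, Finset.mul_sum,
      Finset.sum_congr rfl step, Finset.sum_add_distrib, mul_assoc T, map_mul_pow hDQ, ← mul_assoc,
      add_assoc]
    congr 1
    simp only [e, map_add, mul_add, Finset.sum_add_distrib, Nat.add_sub_cancel]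
    rw [Finset.sum_range_succ, hlast, map_zero, mul_zero, add_zero, add_assoc]
    congr 1
    rw [Finset.sum_range_succ', hb0]
    simp [mul_assoc]

/-- The series `∑_k (θ^k / k!) Q^k D(1 / (c (c + 1) ⋯ (c + k - 1))) X^k`. -/
def wSer (θ : ℝ) (Q : R) (D : (ℝ → ℝ) →ₐ[ℝ] R) : PowerSeries R :=
  PowerSeries.mk fun k => (θ ^ k / (k ! : ℝ)) • (Q ^ k * D fun c => (rising c k)⁻¹)

/-- In degree `k` the commutator terms of `H Q^k` cancel one by one against the terms `T^(l+1) / (l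
+ 1)` of the logarithm. The denominators in `wSer` are chosen for this cancellation. Since these
denominators must not vanish, functions of `c` are compared only for `c > 0`, which `hD` permits. -/
lemma logSer_mul_wSer (hDT : ∀ f, D f * T = T * D fun c => f (c + 2))
    (hDQ : ∀ f, D f * Q = Q * D fun c => f (c + 2))
    (hQT : Q * T = T * Q + T ^ 2 * D fun c => c + 1)
    (hHQ : H * Q = Q * H + T * D fun c => c) (hDH : ∀ f, D f * H = H * D f)
    (hD : ∀ f g : ℝ → ℝ, (∀ c, 0 < c → f c = g c) → D f = D g) (θ : ℝ) :
    logSer θ H T * wSer θ Q D = wSer θ Q D * PowerSeries.C H := by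
  ext1 k
  rw [PowerSeries.coeff_mul_C, PowerSeries.coeff_mul,
    Finset.Nat.sum_antidiagonal_eq_sum_range_succ_mk, Finset.sum_range_succ']
  simp only [logSer, wSer, PowerSeries.coeff_mk, ↓reduceIte, Nat.add_eq_zero_iff, one_ne_zero,
    and_false, Nat.sub_zero]
  rw [mul_smul_comm, ← mul_assoc, mul_pow_eq_add_sum hDT hDQ hQT hHQ, add_mul, mul_assoc (Q ^ k),
    ← hDH, smul_add, Finset.sum_mul, Finset.smul_sum, add_left_comm, ← Finset.sum_add_distrib,
    Finset.sum_eq_zero, add_zero, smul_mul_assoc, mul_assoc]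
  intro l hl
  have hl' := Finset.mem_range.1 hl
  have hk : k - (l + 1) = k - 1 - l := by omega
  -- The rising factorial of length `k` splits as one of length `k - 1 - l` times the one inside
  -- `commCoeff`, which cancels and leaves a constant multiple.
  have key : D (commCoeff k l) * D (fun c => (rising c k)⁻¹) =
      ((k ! : ℝ) / (((l : ℝ) + 1) * ((k - 1 - l) ! : ℝ))) •
        D fun c => (rising c (k - 1 - l))⁻¹ := by
    rw [← map_mul, ← map_smul]
    refine hD _ _ fun c hc => ?_
    simp only [Pi.mul_apply, Pi.smul_apply, smul_eq_mul, commCoeff]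
    have h1 : rising c k = rising c (k - 1 - l) * rising (c + k - l - 1) (l + 1) := by
      conv_lhs => rw [show k = (k - 1 - l) + (l + 1) by omega]
      rw [rising_add]
      congr 2
      rw [Nat.cast_sub (by omega), Nat.cast_sub (by omega)]
      push_cast; ring
    have h2 := (rising_pos hc k).ne'
    rw [h1] at h2
    have h3 := left_ne_zero_of_mul h2
    have h4 := right_ne_zero_of_mul h2
    have h5 : ((k.choose (l + 1) * (l + 1) ! * (k - (l + 1)) ! : ℕ) : ℝ) = k ! := by
      rw [Nat.choose_mul_factorial_mul_factorial (by omega)]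
    rw [hk, Nat.factorial_succ] at h5
    have h6 : (((k - 1 - l) ! : ℕ) : ℝ) ≠ 0 := by exact_mod_cast Nat.factorial_ne_zero _
    have h7 : ((l : ℝ) + 1) ≠ 0 := by positivity
    rw [h1, ← h5]
    push_cast
    field_simp
  rw [smul_mul_smul_comm, mul_assoc (T ^ (l + 1) * _), key, mul_smul_comm, smul_smul, hk,
    ← mul_assoc, ← add_smul]
  have h6 : (((k - 1 - l) ! : ℕ) : ℝ) ≠ 0 := by exact_mod_cast Nat.factorial_ne_zero _
  have h7 : ((l : ℝ) + 1) ≠ 0 := by positivity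
  have h8 : ((k ! : ℕ) : ℝ) ≠ 0 := by exact_mod_cast Nat.factorial_ne_zero _
  have h9 : θ ^ k = θ ^ (l + 1) * θ ^ (k - 1 - l) := by rw [← pow_add]; congr 1; omega
  convert zero_smul ℝ _
  rw [h9]
  push_cast
  field_simp
  ring

end Intertwining

/-! ### Identities for the jump rates -/

/-- `k φ_s(k, m)`, with value `1` at `k = 0`. -/
def rate (s : ℝ) (k m : ℕ) : ℝ :=
  (m.descFactorial k : ℝ) / rising ((m : ℝ) - k + 2 * s) k

section Rates

variable {s : ℝ}

@[simp] lemma rate_zero (s : ℝ) (m : ℕ) : rate s 0 m = 1 := by simp [rate, rising_zero]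

lemma rate_of_lt {k m : ℕ} (h : m < k) : rate s k m = 0 := by
  simp [rate, Nat.descFactorial_of_lt h]

lemma phi_zero_right (s : ℝ) (k : ℕ) : phi s k 0 = 0 := by
  rw [phi, if_neg (by omega)]

/-- Removes the Gamma functions: the recursions for `phi` then follow from recursions between
products of linear factors. -/
lemma mul_phi (hs : 0 < s) (k m : ℕ) : ((k : ℝ) + 1) * phi s (k + 1) m = rate s (k + 1) m := by
  by_cases h : k + 1 ≤ m
  · have h1 : 0 < (m : ℝ) - ((k + 1 : ℕ) : ℝ) + 2 * s := by
      have : ((k + 1 : ℕ) : ℝ) ≤ m := by exact_mod_cast h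
      linarith
    have h2 := Gamma_add_nat h1 (k + 1)
    rw [show (m : ℝ) - ((k + 1 : ℕ) : ℝ) + 2 * s + ((k + 1 : ℕ) : ℝ) = m + 2 * s by ring] at h2
    have h3 : (m : ℝ) - ((k + 1 : ℕ) : ℝ) + 1 = ((m - (k + 1) : ℕ) : ℝ) + 1 := by
      rw [Nat.cast_sub h]
    have h4 := Nat.factorial_mul_descFactorial h
    have h5 : ((m - (k + 1)) ! : ℝ) ≠ 0 := by exact_mod_cast Nat.factorial_ne_zero _
    have h6 := (rising_pos h1 (k + 1)).ne'
    have h7 := (Real.Gamma_pos_of_pos h1).ne'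
    have h8 : ((k : ℝ) + 1) ≠ 0 := by positivity
    rw [phi, if_pos ⟨by omega, h⟩, h2, h3, Real.Gamma_nat_eq_factorial,
      Real.Gamma_nat_eq_factorial, ← h4, rate]
    push_cast at *
    field_simp
  · rw [phi, if_neg (by omega), rate_of_lt (by omega), mul_zero]

lemma rate_succ (hs : 0 < s) (k m : ℕ) :
    rate s (k + 1) m * ((m : ℝ) - k - 1 + 2 * s) = ((m : ℝ) - k) * rate s k m := by
  by_cases h : k + 1 ≤ m
  · have h0 : ((k : ℝ) + 1) ≤ m := by exact_mod_cast h
    have h1 : 0 < (m : ℝ) - k - 1 + 2 * s := by linarith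
    have h2 : 0 < (m : ℝ) - k + 2 * s := by linarith
    have h3 := (rising_pos h2 k).ne'
    rw [rate, rate, rising_succ', Nat.descFactorial_succ]
    have e1 : (m : ℝ) - ((k + 1 : ℕ) : ℝ) + 2 * s + 1 = m - k + 2 * s := by push_cast; ring
    have e2 : (m : ℝ) - ((k + 1 : ℕ) : ℝ) + 2 * s = m - k - 1 + 2 * s := by push_cast; ring
    have h4 := h1.ne'
    rw [e1, e2]
    push_cast [Nat.cast_sub (show k ≤ m by omega)]
    field_simp
  · rw [rate_of_lt (by omega), zero_mul]
    rcases (show m = k ∨ m < k by omega) with rfl | h'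
    · simp
    · rw [rate_of_lt h', mul_zero]

lemma rate_succ_succ (hs : 0 < s) (k m : ℕ) :
    ((m : ℝ) + 2 * s) * rate s (k + 1) (m + 1) = ((m : ℝ) + 1) * rate s k m := by
  by_cases h : k ≤ m
  · have h0 : (k : ℝ) ≤ m := by exact_mod_cast h
    have h2 : 0 < (m : ℝ) - k + 2 * s := by linarith
    have h3 := (rising_pos h2 k).ne'
    have h4 : (m : ℝ) + 2 * s ≠ 0 := by positivity
    rw [rate, rate, rising_succ, Nat.succ_descFactorial_succ]
    have e1 : ((m + 1 : ℕ) : ℝ) - ((k + 1 : ℕ) : ℝ) + 2 * s = m - k + 2 * s := by push_cast; ring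
    have e2 : (m : ℝ) - k + 2 * s + k = m + 2 * s := by ring
    rw [e1, e2]
    push_cast
    field_simp
  · rw [rate_of_lt (by omega), rate_of_lt (by omega), mul_zero, mul_zero]

/-- The recursion behind the commutators with raising operators. -/
lemma phi_succ_right (hs : 0 < s) (k m : ℕ) :
    ((m : ℝ) + 2 * s) * phi s (k + 1) (m + 1) =
      phi s (k + 1) m * ((m : ℝ) - (k + 1) + 2 * s) + rate s k m := by
  have h1 := mul_phi hs k m
  have h2 := mul_phi hs k (m + 1)
  have h3 := rate_succ hs k m
  have h4 := rate_succ_succ hs k m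
  have h5 : ((k : ℝ) + 1) ≠ 0 := by positivity
  rw [← mul_right_inj' h5]
  linear_combination ((m : ℝ) + 2 * s) * h2 + h4 - h3 - ((m : ℝ) - k - 1 + 2 * s) * h1

/-- The counterpart for lowering operators. -/
lemma phi_succ_succ (hs : 0 < s) (k m : ℕ) :
    ((m : ℝ) + 1) * phi s (k + 1) m =
      ((m : ℝ) - k) * phi s (k + 1) (m + 1) + ((k : ℝ) + 2) * phi s (k + 2) (m + 1) := by
  have h1 := mul_phi hs k m
  have h2 := mul_phi hs k (m + 1)
  have h3 := rate_succ hs (k + 1) (m + 1)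
  have h4 := rate_succ_succ hs (k + 1) m
  have h6 := mul_phi hs (k + 1) (m + 1)
  have h5 : ((k : ℝ) + 1) ≠ 0 := by positivity
  have h7 : (m : ℝ) + 2 * s ≠ 0 := by positivity
  push_cast at h3 h6
  rw [← mul_right_inj' h5, ← mul_right_inj' h7]
  linear_combination ((m : ℝ) + 2 * s) * ((m : ℝ) + 1) * h1 - (m + 2 * s) * (m - k) * h2
    - (m + 2 * s) * (k + 1) * h6 - (m + 2 * s) * (-h3) - (m + 2 * s) * h4

lemma phi_one (hs : 0 < s) (m : ℕ) : phi s 1 m * ((m : ℝ) - 1 + 2 * s) = m := by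
  have h1 := mul_phi hs 0 m
  have h2 := rate_succ hs 0 m
  simp only [Nat.cast_zero, zero_add, one_mul, sub_zero, rate_zero, mul_one] at h1 h2
  rw [h1, h2]

variable {V : Type*} [AddCommGroup V] [Module ℝ V]

lemma sum_Icc_one {V : Type*} [AddCommMonoid V] (f : ℕ → V) (m : ℕ) :
    ∑ k ∈ Finset.Icc 1 m, f k = ∑ k ∈ Finset.range m, f (k + 1) := by
  rw [Finset.range_eq_Ico, Finset.sum_Ico_add' f 0 m 1]
  rfl

/-- Termwise `phi_succ_right`; the extra `v 1` is the term `rate s 0 m = 1`. In the applications `v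
k` is the configuration reached by moving `k` particles. -/
lemma sum_phi_raise (hs : 0 < s) (m : ℕ) (v : ℕ → V) :
    ∑ k ∈ Finset.Icc 1 (m + 1), (((m : ℝ) + 2 * s) * phi s k (m + 1)) • v k =
      ∑ k ∈ Finset.Icc 1 m, phi s k m • (((m : ℝ) - k + 2 * s) • v k + (k : ℝ) • v (k + 1)) +
        v 1 := by
  have hz : phi s (m + 1) m = 0 := by rw [phi, if_neg (by omega)]
  have e1 : ∀ k, (((m : ℝ) + 2 * s) * phi s (k + 1) (m + 1)) • v (k + 1) =
      (phi s (k + 1) m * ((m : ℝ) - (k + 1) + 2 * s)) • v (k + 1) + rate s k m • v (k + 1) :=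
    fun k => by rw [phi_succ_right hs, add_smul]
  have e2 : ∀ k, phi s (k + 1) m • (((m : ℝ) - (k + 1 : ℕ) + 2 * s) • v (k + 1) +
      ((k + 1 : ℕ) : ℝ) • v (k + 1 + 1)) =
      (phi s (k + 1) m * ((m : ℝ) - (k + 1) + 2 * s)) • v (k + 1) +
        rate s (k + 1) m • v (k + 1 + 1) := fun k => by
    rw [← mul_phi hs]; push_cast; module
  simp only [sum_Icc_one, e1, e2, Finset.sum_add_distrib]
  rw [Finset.sum_range_succ, hz, zero_mul, zero_smul, add_zero, Finset.sum_range_succ', rate_zero,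
    one_smul, zero_add, add_assoc]

lemma sum_phi_lower (hs : 0 < s) (m : ℕ) (v : ℕ → V) :
    ∑ k ∈ Finset.Icc 1 (m + 1), phi s k (m + 1) •
        ((((m + 1 : ℕ) : ℝ) - k) • v (k + 1) + (k : ℝ) • v k) =
      ∑ k ∈ Finset.Icc 1 m, (((m : ℝ) + 1) * phi s k m) • v (k + 1) + phi s 1 (m + 1) • v 1 := by
  have e1 : ∀ k, phi s (k + 1) (m + 1) • ((((m + 1 : ℕ) : ℝ) - (k + 1 : ℕ)) • v (k + 1 + 1) +
      ((k + 1 : ℕ) : ℝ) • v (k + 1)) = (((m : ℝ) - k) * phi s (k + 1) (m + 1)) • v (k + 1 + 1) +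
        (((k : ℝ) + 1) * phi s (k + 1) (m + 1)) • v (k + 1) := fun k => by push_cast; module
  have e2 : ∀ k, (((m : ℝ) + 1) * phi s (k + 1) m) • v (k + 1 + 1) =
      (((m : ℝ) - k) * phi s (k + 1) (m + 1)) • v (k + 1 + 1) +
        (((k + 1 : ℕ) + 1 : ℝ) * phi s (k + 1 + 1) (m + 1)) • v (k + 1 + 1) := fun k => by
    rw [phi_succ_succ hs, add_smul]; push_cast; module
  simp only [sum_Icc_one, e1, e2, Finset.sum_add_distrib]
  rw [Finset.sum_range_succ, sub_self, zero_mul, zero_smul, add_zero, Finset.sum_range_succ']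
  simp [add_assoc]

/-- Since `k φ_s(k, m)` is `rate`, `rate_succ` makes each summand a difference of consecutive values
of `g`, which vanishes at the upper end `k = m`. -/
lemma sum_phi_telescope (hs : 0 < s) (m : ℕ) (v : ℕ → V) :
    ∑ k ∈ Finset.Icc 1 m, ((k : ℝ) * phi s k m) •
        (((m : ℝ) - k) • v (k + 1) - ((m : ℝ) - k + 2 * s) • v k) = -((m : ℝ) • v 1) := by
  set g : ℕ → V := fun k => (((m : ℝ) - k) * rate s k m) • v (k + 1) with hg
  have hstep : ∀ k, (((k + 1 : ℕ) : ℝ) * phi s (k + 1) m) •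
      (((m : ℝ) - (k + 1 : ℕ)) • v (k + 1 + 1) - ((m : ℝ) - (k + 1 : ℕ) + 2 * s) • v (k + 1)) =
      g (k + 1) - g k := by
    intro k
    have h1 := mul_phi hs k m
    have h2 := rate_succ hs k m
    rw [hg]
    simp only
    rw [← h2]
    push_cast
    rw [h1]
    module
  rw [sum_Icc_one, Finset.sum_congr rfl fun k _ => hstep k, Finset.sum_range_sub, hg]
  simp

/-- Division-free form of `h_s(m + 1) - h_s(m) = 1 / (m + 2 s)`, obtained from `sum_phi_raise` with
constant `v`. -/
lemma harm_succ (hs : 0 < s) (m : ℕ) :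
    ((m : ℝ) + 2 * s) * harm s (m + 1) = ((m : ℝ) + 2 * s) * harm s m + 1 := by
  have h := sum_phi_raise (V := ℝ) hs m fun _ => 1
  simp only [smul_eq_mul, mul_one] at h
  rw [harm, Finset.mul_sum, h, harm, Finset.mul_sum]
  congr 1
  exact Finset.sum_congr rfl fun k _ => by ring

@[simp] lemma harm_zero (s : ℝ) : harm s 0 = 0 := by simp [harm]

end Rates

/-! ### The operators of the chain as endomorphisms -/

section Operators

variable {n : ℕ}

/-- The diagonal endomorphism with eigenvalues `f`. -/
def dg (f : Config n → ℝ) : EndV n := opOf fun m => f m • vec m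

/-- The shift `|m⟩ ↦ |m + δ_i⟩`. -/
def shiftE (i : Fin (n + 1)) : EndV n := opOf fun m => vec (m + pile i 1)

/-- `S_+^{[i]}`. -/
def raiseE (s : ℝ) (i : Fin (n + 1)) : EndV n :=
  opOf fun m => ((m i : ℝ) + 2 * s) • vec (m + pile i 1)

/-- `S_-^{[i]}`. -/
def lowerE (i : Fin (n + 1)) : EndV n := opOf fun m => (m i : ℝ) • vec (m - pile i 1)

/-- The jumps from site `i` to site `j`. -/
def hopE (s : ℝ) (i j : Fin (n + 1)) : EndV n :=
  opOf fun m => ∑ k ∈ Finset.Icc 1 (m i), phi s k (m i) • vec (m - pile i k + pile j k)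

/-- The diagonal operator `h_s(m_i)`. -/
def harmE (s : ℝ) (i : Fin (n + 1)) : EndV n := dg fun m => harm s (m i)

/-- The Hamiltonian density. -/
def bulkE (s : ℝ) (i j : Fin (n + 1)) : EndV n :=
  harmE s i + harmE s j - hopE s i j - hopE s j i

@[simp] lemma dg_vec (f : Config n → ℝ) (m : Config n) : dg f (vec m) = f m • vec m :=
  opOf_vec _ _

@[simp] lemma shiftE_vec (i : Fin (n + 1)) (m : Config n) :
    shiftE i (vec m) = vec (m + pile i 1) := opOf_vec _ _

@[simp] lemma raiseE_vec (s : ℝ) (i : Fin (n + 1)) (m : Config n) :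
    raiseE s i (vec m) = ((m i : ℝ) + 2 * s) • vec (m + pile i 1) := opOf_vec _ _

@[simp] lemma lowerE_vec (i : Fin (n + 1)) (m : Config n) :
    lowerE i (vec m) = (m i : ℝ) • vec (m - pile i 1) := opOf_vec _ _

@[simp] lemma hopE_vec (s : ℝ) (i j : Fin (n + 1)) (m : Config n) :
    hopE s i j (vec m) =
      ∑ k ∈ Finset.Icc 1 (m i), phi s k (m i) • vec (m - pile i k + pile j k) := opOf_vec _ _

@[simp] lemma harmE_vec (s : ℝ) (i : Fin (n + 1)) (m : Config n) :
    harmE s i (vec m) = harm s (m i) • vec m := opOf_vec _ _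

lemma bulkE_apply (s : ℝ) (i j : Fin (n + 1)) (v : Config n →₀ ℝ) :
    bulkE s i j v = harmE s i v + harmE s j v - hopE s i j v - hopE s j i v := rfl

/-! ### Matrices -/

lemma mat_raiseE (s : ℝ) (i : Fin (n + 1)) : mat (raiseE s i) = Sp s i := by
  ext p m
  simp [mat_apply, Sp, ket_eq]

lemma mat_lowerE (i : Fin (n + 1)) : mat (lowerE i) = Sm (n := n) i := by
  ext p m
  simp [mat_apply, Sm, ket_eq]

lemma mat_dg (f : Config n → ℝ) : mat (dg f) = Matrix.diagonal f := by
  ext p m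
  by_cases h : p = m
  · simp [mat_apply, h]
  · simp [mat_apply, vec_of_ne h, h]

lemma S0_eq (s : ℝ) (i : Fin (n + 1)) : S0 s i = Matrix.diagonal fun m => (m i : ℝ) + s := by
  ext p m
  by_cases h : p = m <;> simp [S0, ket, h]

lemma mat_bulkE (s : ℝ) (i j : Fin (n + 1)) : mat (bulkE s i j) = bulk (n := n) s i j := by
  ext p m
  simp [mat_apply, bulk, bulkE_apply, ket_eq, add_mul]

/-! ### Degrees -/

lemma size_add (m q : Config n) : size (m + q) = size m + size q := by
  simp [size, Finset.sum_add_distrib]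

lemma size_pile (i : Fin (n + 1)) (k : ℕ) : size (pile i k : Config n) = k := by
  simp [size, pile]

lemma sub_pile_add_pile {m : Config n} {i : Fin (n + 1)} {k : ℕ} (h : k ≤ m i) :
    m - pile i k + pile i k = m := by
  ext l
  by_cases hl : l = i
  · subst hl; simp [pile]; omega
  · simp [pile, hl]

lemma size_sub_pile {m : Config n} {i : Fin (n + 1)} {k : ℕ} (h : k ≤ m i) :
    size (m - pile i k) + k = size m := by
  conv_rhs => rw [← sub_pile_add_pile h, size_add, size_pile]

lemma HasDeg.of_vec {d : ℤ} {f : EndV n} {v : Config n → (Config n →₀ ℝ)}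
    (hf : ∀ m, f (vec m) = v m) (h : ∀ m p, v m p ≠ 0 → (size p : ℤ) = size m + d) :
    HasDeg d f := fun m p hp => h m p (by rwa [← hf])

lemma eq_of_smul_vec_ne_zero {c : ℝ} {q p : Config n} (h : (c • vec q) p ≠ 0) :
    c ≠ 0 ∧ p = q := by
  rw [Finsupp.smul_apply, smul_eq_mul] at h
  exact ⟨left_ne_zero_of_mul h, eq_of_vec_ne_zero (right_ne_zero_of_mul h)⟩

lemma hasDeg_dg (f : Config n → ℝ) : HasDeg 0 (dg f) :=
  .of_vec (dg_vec f) fun m p h => by simp [(eq_of_smul_vec_ne_zero h).2]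

lemma hasDeg_shiftE (i : Fin (n + 1)) : HasDeg 1 (shiftE (n := n) i) :=
  .of_vec (shiftE_vec i) fun m p h => by
    simp [eq_of_vec_ne_zero h, size_add, size_pile]

lemma hasDeg_raiseE (s : ℝ) (i : Fin (n + 1)) : HasDeg 1 (raiseE (n := n) s i) :=
  .of_vec (raiseE_vec s i) fun m p h => by
    simp [(eq_of_smul_vec_ne_zero h).2, size_add, size_pile]

lemma hasDeg_lowerE (i : Fin (n + 1)) : HasDeg (-1) (lowerE (n := n) i) :=
  .of_vec (lowerE_vec i) fun m p h => by
    obtain ⟨h1, h2⟩ := eq_of_smul_vec_ne_zero h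
    have h3 : m i ≠ 0 := by exact_mod_cast h1
    have := size_sub_pile (m := m) (i := i) (k := 1) (by omega)
    rw [h2]
    omega

lemma hasDeg_hopE (s : ℝ) (i j : Fin (n + 1)) : HasDeg 0 (hopE (n := n) s i j) :=
  .of_vec (hopE_vec s i j) fun m p h => by
    rw [Finsupp.finsetSum_apply] at h
    obtain ⟨k, hk, h1⟩ := Finset.exists_ne_zero_of_sum_ne_zero h
    have := size_sub_pile (m := m) (i := i) (k := k) (Finset.mem_Icc.1 hk).2
    rw [(eq_of_smul_vec_ne_zero h1).2, size_add, size_pile]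
    omega

lemma hasDeg_bulkE (s : ℝ) (i j : Fin (n + 1)) : HasDeg 0 (bulkE (n := n) s i j) :=
  (((hasDeg_dg _).add (hasDeg_dg _)).sub (hasDeg_hopE s i j)).sub (hasDeg_hopE s j i)

/-! ### Commutation relations -/

lemma dg_mul (f g : Config n → ℝ) : dg (f * g) = dg f * dg g :=
  endV_ext fun m => by simp [smul_smul, mul_comm]

lemma dg_add (f g : Config n → ℝ) : dg (f + g) = dg f + dg g :=
  endV_ext fun m => by simp [add_smul]

lemma dg_commute (f g : Config n → ℝ) : dg f * dg g = dg g * dg f := by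
  rw [← dg_mul, ← dg_mul, mul_comm]

/-- Diagonal operators that depend only on the total number of particles, shifted and rescaled. -/
def sizeHom (n : ℕ) (b : ℝ) : (ℝ → ℝ) →ₐ[ℝ] EndV n :=
  AlgHom.ofLinearMap
    { toFun := fun f => dg fun m => f (2 * (size m : ℝ) + b)
      map_add' := fun f g => dg_add _ _
      map_smul' := fun c f => endV_ext fun m => by simp [smul_smul] }
    (endV_ext fun m => by simp) fun f g => dg_mul _ _

lemma sizeHom_apply (b : ℝ) (f : ℝ → ℝ) :
    sizeHom n b f = dg fun m => f (2 * (size m : ℝ) + b) := rfl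

lemma dg_apply (f : Config n → ℝ) (v : Config n →₀ ℝ) (p : Config n) :
    dg f v p = f p * v p := by
  rw [apply_eq_sum]
  simp only [dg_vec, Finsupp.smul_apply, smul_eq_mul, mul_assoc]
  by_cases h : p ∈ v.support
  · rw [Finset.sum_eq_single p]
    · simp
    · intro q _ hq; simp [vec_of_ne hq.symm]
    · intro h'; exact absurd h h'
  · rw [Finset.sum_eq_zero, Finsupp.notMem_support_iff.1 h, mul_zero]
    intro q hq
    have : q ≠ p := by rintro rfl; exact h hq
    simp [vec_of_ne this.symm]

/-- The argument `2 · size + b` grows by `2 d` under an operator that adds `d` particles. -/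
lemma sizeHom_mul {d : ℕ} {A : EndV n} (hA : HasDeg d A) (b : ℝ) (f : ℝ → ℝ) :
    sizeHom n b f * A = A * sizeHom n b fun c => f (c + 2 * d) := by
  refine endV_ext fun m => ?_
  ext p
  rw [sizeHom_apply, Module.End.mul_apply, dg_apply, Module.End.mul_apply, sizeHom_apply, dg_vec,
    map_smul, Finsupp.smul_apply, smul_eq_mul]
  by_cases h : A (vec m) p = 0
  · simp [h]
  · have h1 : (size p : ℝ) = size m + d := by exact_mod_cast hA m p h
    rw [h1]
    congr 2
    ring

lemma pile_add (i : Fin (n + 1)) (k l : ℕ) : (pile i (k + l) : Config n) = pile i k + pile i l :=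
  Pi.single_add (f := fun _ => ℕ) i k l

lemma pile_apply_self (i : Fin (n + 1)) (k : ℕ) : (pile i k : Config n) i = k := by simp [pile]

lemma pile_apply_of_ne {i j : Fin (n + 1)} (h : j ≠ i) (k : ℕ) : (pile i k : Config n) j = 0 := by
  simp [pile, h]

lemma shiftE_pow_vec (i : Fin (n + 1)) (k : ℕ) (m : Config n) :
    (shiftE i ^ k) (vec m) = vec (m + pile i k) := by
  induction k generalizing m with
  | zero => simp [pile]
  | succ k ih => rw [pow_succ, Module.End.mul_apply, shiftE_vec, ih, add_assoc, ← pile_add,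
      add_comm 1 k]

lemma raiseE_eq (s : ℝ) (i : Fin (n + 1)) :
    raiseE s i = shiftE i * dg fun m => (m i : ℝ) + 2 * s :=
  endV_ext fun m => by simp

lemma raiseE_mul_shiftE (s : ℝ) (i : Fin (n + 1)) :
    raiseE s i * shiftE i = shiftE (n := n) i * raiseE s i + shiftE i ^ 2 :=
  endV_ext fun m => by
    simp [pile_apply_self, pow_two]
    module

lemma raiseE_mul_shiftE_of_ne (s : ℝ) {i j : Fin (n + 1)} (h : i ≠ j) :
    raiseE s i * shiftE j = shiftE (n := n) j * raiseE s i :=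
  endV_ext fun m => by
    simp [pile_apply_of_ne h, add_right_comm]

/-- The increment `1 / (m_i + 2 s)` of `h_s` cancels the matrix element of `S_+`, leaving the bare
shift. -/
lemma harmE_mul_raiseE {s : ℝ} (hs : 0 < s) (i : Fin (n + 1)) :
    harmE s i * raiseE s i = raiseE s i * harmE (n := n) s i + shiftE i :=
  endV_ext fun m => by
    simp only [Module.End.mul_apply, raiseE_vec, map_smul, harmE_vec, Pi.add_apply,
      pile_apply_self, LinearMap.add_apply, shiftE_vec, smul_smul]
    rw [harm_succ hs]
    module

lemma harmE_mul_raiseE_of_ne (s : ℝ) {i j : Fin (n + 1)} (h : i ≠ j) :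
    harmE s i * raiseE s j = raiseE s j * harmE (n := n) s i :=
  endV_ext fun m => by
    simp [pile_apply_of_ne h, smul_smul, mul_comm]

end Operators

/-! ### Hopping between two sites and the raising operators -/

section TwoSites

variable {n : ℕ} {s : ℝ} {i j : Fin (n + 1)}

lemma hopE_mul_raiseE_of_ne (s : ℝ) {l : Fin (n + 1)} (hli : l ≠ i) (hlj : l ≠ j) :
    hopE s i j * raiseE s l = raiseE s l * hopE (n := n) s i j :=
  endV_ext fun m => by
    simp only [Module.End.mul_apply, raiseE_vec, map_smul, hopE_vec, map_sum, Finset.smul_sum,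
      Pi.add_apply, Pi.sub_apply, pile_apply_of_ne hli, pile_apply_of_ne hlj,
      pile_apply_of_ne hli.symm, add_zero, Nat.sub_zero, smul_smul]
    refine Finset.sum_congr rfl fun k hk => ?_
    rw [mul_comm]
    congr 2
    ext x
    have := (Finset.mem_Icc.1 hk).2
    by_cases hx : x = i
    · subst hx; simp [pile, hli.symm]
    · simp [pile, hx]; omega

lemma hopE_mul_lowerE_of_ne (s : ℝ) {l : Fin (n + 1)} (hli : l ≠ i) (hlj : l ≠ j) :
    hopE s i j * lowerE l = lowerE l * hopE (n := n) s i j :=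
  endV_ext fun m => by
    simp only [Module.End.mul_apply, lowerE_vec, map_smul, hopE_vec, map_sum, Finset.smul_sum,
      Pi.add_apply, Pi.sub_apply, pile_apply_of_ne hli, pile_apply_of_ne hlj,
      pile_apply_of_ne hli.symm, add_zero, Nat.sub_zero, smul_smul]
    refine Finset.sum_congr rfl fun k hk => ?_
    rw [mul_comm]
    congr 3
    ext x
    by_cases hx : x = l
    · subst hx; simp [pile, hli, hlj]
    · simp [pile, hx]

lemma hopE_mul_dg {g : Config n → ℝ}
    (hg : ∀ m k, k ≤ m i → g (m - pile i k + pile j k) = g m) :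
    hopE s i j * dg g = dg g * hopE s i j :=
  endV_ext fun m => by
    simp only [Module.End.mul_apply, dg_vec, map_smul, hopE_vec, map_sum, Finset.smul_sum,
      smul_smul]
    refine Finset.sum_congr rfl fun k hk => ?_
    rw [hg _ _ (Finset.mem_Icc.1 hk).2, mul_comm]

lemma raise_hop (hij : i ≠ j) {m : Config n} {k : ℕ} (hk : k ≤ m i) :
    m + pile j 1 - pile i k + pile j k = m + pile i 1 - pile i (k + 1) + pile j (k + 1) ∧
    m - pile i k + pile j k + pile i 1 = m + pile i 1 - pile i k + pile j k ∧
    m - pile i k + pile j k + pile j 1 = m + pile i 1 - pile i (k + 1) + pile j (k + 1) := by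
  refine ⟨?_, ?_, ?_⟩ <;>
  · ext x
    by_cases hx : x = i
    · subst hx; simp [pile, hij]; try omega
    · by_cases hx' : x = j
      · subst hx'; simp [pile, hx]; try omega
      · simp [pile, hx, hx']

lemma hopE_raise_vec (hs : 0 < s) (i j : Fin (n + 1)) (m : Config n) :
    ((m i : ℝ) + 2 * s) • hopE s i j (vec (m + pile i 1)) =
      ∑ k ∈ Finset.Icc 1 (m i), phi s k (m i) •
        (((m i : ℝ) - k + 2 * s) • vec (m + pile i 1 - pile i k + pile j k) +
          (k : ℝ) • vec (m + pile i 1 - pile i (k + 1) + pile j (k + 1))) +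
        vec (m + pile j 1) := by
  have h := sum_phi_raise hs (m i) fun k => vec (m + pile i 1 - pile i k + pile j k)
  rw [add_tsub_cancel_right] at h
  rw [hopE_vec, Pi.add_apply, pile_apply_self, Finset.smul_sum, ← h]
  simp only [smul_smul]

/-- The defect is the boundary term `v 1` of `sum_phi_raise`; in the bulk density it cancels `[h_j,
S_+^{[j]}]`. -/
lemma hopE_mul_raiseE (hs : 0 < s) (hij : i ≠ j) :
    hopE s i j * (raiseE s i + raiseE s j) =
      (raiseE s i + raiseE s j) * hopE (n := n) s i j + shiftE j :=
  endV_ext fun m => by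
    simp only [Module.End.mul_apply, LinearMap.add_apply, raiseE_vec, map_smul, map_add,
      shiftE_vec, hopE_raise_vec hs i j]
    rw [hopE_vec, hopE_vec, map_sum, map_sum, Finset.smul_sum, ← Finset.sum_add_distrib,
      add_right_comm, Pi.add_apply, pile_apply_of_ne hij, add_zero, ← Finset.sum_add_distrib]
    congr 1
    refine Finset.sum_congr rfl fun k hk => ?_
    have hk' := (Finset.mem_Icc.1 hk).2
    obtain ⟨h1, h2, h3⟩ := raise_hop hij hk'
    rw [map_smul, map_smul, raiseE_vec, raiseE_vec, h1, h2, h3]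
    simp only [Pi.add_apply, Pi.sub_apply, pile_apply_self, pile_apply_of_ne hij,
      pile_apply_of_ne hij.symm, add_zero, Nat.sub_zero]
    push_cast [hk']
    module

/-- Here the combination of weights leaves, besides the boundary term of `sum_phi_raise`, a sum that
`sum_phi_telescope` collapses to a multiple of the same shifted vector. -/
lemma hopE_mul_twist (hs : 0 < s) (hij : i ≠ j) :
    hopE s i j *
        (raiseE s i * dg (fun m => (m j : ℝ) + s) - raiseE s j * dg fun m => (m i : ℝ) + s) =
      (raiseE s i * dg (fun m => (m j : ℝ) + s) - raiseE s j * dg fun m => (m i : ℝ) + s) *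
        hopE (n := n) s i j + shiftE j * dg fun m => (m j : ℝ) + s - m i :=
  endV_ext fun m => by
    have ht := sum_phi_telescope hs (m i) fun k => vec (m + pile i 1 - pile i k + pile j k)
    rw [add_tsub_cancel_right] at ht
    have ht' : (m i : ℝ) • vec (m + pile j 1) = -∑ k ∈ Finset.Icc 1 (m i),
        ((k : ℝ) * phi s k (m i)) •
        (((m i : ℝ) - k) • vec (m + pile i 1 - pile i (k + 1) + pile j (k + 1)) -
          ((m i : ℝ) - k + 2 * s) • vec (m + pile i 1 - pile i k + pile j k)) := by
      rw [ht, neg_neg]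
    simp only [Module.End.mul_apply, LinearMap.add_apply, LinearMap.sub_apply, raiseE_vec, map_smul,
      map_sub, shiftE_vec, hopE_raise_vec hs i j, dg_vec]
    rw [sub_smul ((m j : ℝ) + s), ht', hopE_vec, hopE_vec, Pi.add_apply, pile_apply_of_ne hij,
      add_zero]
    simp only [map_sum, Finset.smul_sum, smul_add]
    rw [sub_neg_eq_add, add_sub_right_comm, ← add_assoc, add_right_comm (_ - _)]
    congr 1
    rw [← Finset.sum_sub_distrib, ← Finset.sum_sub_distrib, ← Finset.sum_add_distrib]
    refine Finset.sum_congr rfl fun k hk => ?_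
    have hk' := (Finset.mem_Icc.1 hk).2
    obtain ⟨h1, h2, h3⟩ := raise_hop hij hk'
    simp only [map_smul, dg_vec, raiseE_vec, h1, h2, h3]
    simp only [Pi.add_apply, Pi.sub_apply, pile_apply_self, pile_apply_of_ne hij,
      pile_apply_of_ne hij.symm, add_zero, Nat.sub_zero]
    push_cast [hk']
    module

end TwoSites

/-! ### Hopping and the lowering operators -/

section Lowering

variable {n : ℕ} {s : ℝ} {i j : Fin (n + 1)}

/-- The removal of one particle at site `i` with the jump rate. -/
def removeE (s : ℝ) (i : Fin (n + 1)) : EndV n :=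
  opOf fun m => phi s 1 (m i) • vec (m - pile i 1)

@[simp] lemma removeE_vec (s : ℝ) (i : Fin (n + 1)) (m : Config n) :
    removeE s i (vec m) = phi s 1 (m i) • vec (m - pile i 1) := opOf_vec _ _

lemma lowerE_mul_harmE (hs : 0 < s) (i : Fin (n + 1)) :
    lowerE i * harmE s i = harmE (n := n) s i * lowerE i + removeE s i :=
  endV_ext fun m => by
    simp only [Module.End.mul_apply, lowerE_vec, map_smul, harmE_vec, Pi.sub_apply,
      pile_apply_self, LinearMap.add_apply, removeE_vec, smul_smul]
    rw [← add_smul]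
    congr 1
    rcases hm : m i with _ | M
    · simp [phi_zero_right]
    · have h1 := phi_one hs (M + 1)
      have h2 := harm_succ hs M
      have h3 : (M : ℝ) + 2 * s ≠ 0 := by positivity
      rw [Nat.add_sub_cancel, ← mul_right_inj' h3]
      push_cast at *
      linear_combination ((M : ℝ) + 1) * h2 - h1

lemma lowerE_mul_harmE_of_ne (s : ℝ) (h : i ≠ j) :
    lowerE j * harmE s i = harmE (n := n) s i * lowerE j :=
  endV_ext fun m => by
    simp only [Module.End.mul_apply, lowerE_vec, map_smul, harmE_vec, Pi.sub_apply,
      pile_apply_of_ne h, smul_smul, Nat.sub_zero]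
    rw [mul_comm]

lemma lower_hop (hij : i ≠ j) {m : Config n} {k : ℕ} (hk : 1 ≤ k) :
    m - pile i k + pile j k - pile j 1 = m - pile i k + pile j (k - 1) ∧
    m - pile i k + pile j k - pile i 1 = m - pile i (k + 1) + pile j k ∧
    m - pile i 1 - pile i k + pile j k = m - pile i (k + 1) + pile j k := by
  refine ⟨?_, ?_, ?_⟩ <;>
  · ext x
    by_cases hx : x = i
    · subst hx; simp [pile, hij]; try omega
    · by_cases hx' : x = j
      · subst hx'; simp [pile, hx]; try omega
      · simp [pile, hx, hx']

lemma lower_hop_target (hij : i ≠ j) {m : Config n} (k : ℕ) (hk : 1 ≤ k) (hm : m j ≠ 0) :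
    m - pile j 1 - pile i k + pile j k = m - pile i k + pile j (k - 1) := by
  ext x
  by_cases hx : x = i
  · subst hx; simp [pile, hij]
  · by_cases hx' : x = j
    · subst hx'; simp [pile, hx]; omega
    · simp [pile, hx, hx']

/-- The defect comes from the boundary term of `sum_phi_lower` and equals the one in
`lowerE_mul_harmE`, so the two cancel in the bulk density. -/
lemma lowerE_mul_hopE (hs : 0 < s) (hij : i ≠ j) :
    (lowerE i + lowerE j) * hopE s i j =
      hopE (n := n) s i j * (lowerE i + lowerE j) + removeE s i :=
  endV_ext fun m => by
    simp only [Module.End.mul_apply, LinearMap.add_apply, lowerE_vec, map_smul, map_add,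
      removeE_vec]
    -- For `m j = 0` the truncated subtraction is meaningless, but the scalar `m j` kills the term.
    have hj : (m j : ℝ) • hopE s i j (vec (m - pile j 1)) = ∑ k ∈ Finset.Icc 1 (m i),
        phi s k (m i) • (m j : ℝ) • vec (m - pile i k + pile j (k - 1)) := by
      by_cases hm : m j = 0
      · simp [hm]
      · rw [hopE_vec, Finset.smul_sum, Pi.sub_apply, pile_apply_of_ne hij, Nat.sub_zero]
        refine Finset.sum_congr rfl fun k hk => ?_
        rw [lower_hop_target hij k (Finset.mem_Icc.1 hk).1 hm, smul_comm]
    have hL : lowerE i (hopE s i j (vec m)) + lowerE j (hopE s i j (vec m)) =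
        ∑ k ∈ Finset.Icc 1 (m i), (phi s k (m i) • ((((m i : ℕ) : ℝ) - k) •
          vec (m - pile i (k + 1) + pile j k) + (k : ℝ) • vec (m - pile i k + pile j (k - 1))) +
          phi s k (m i) • (m j : ℝ) • vec (m - pile i k + pile j (k - 1))) := by
      rw [hopE_vec, map_sum, map_sum, ← Finset.sum_add_distrib]
      refine Finset.sum_congr rfl fun k hk => ?_
      obtain ⟨hk1, hk2⟩ := Finset.mem_Icc.1 hk
      obtain ⟨h1, h2, -⟩ := lower_hop hij (m := m) hk1
      simp only [map_smul, lowerE_vec, h1, h2, Pi.add_apply, Pi.sub_apply, pile_apply_self,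
        pile_apply_of_ne hij, pile_apply_of_ne hij.symm, add_zero, Nat.sub_zero]
      push_cast [hk2]
      module
    rw [hL, hj, Finset.sum_add_distrib, add_right_comm]
    congr 1
    rcases hm : m i with _ | M
    · simp [phi_zero_right]
    · have hlow := sum_phi_lower hs M fun k => vec (m - pile i k + pile j (k - 1))
      simp only [Nat.add_sub_cancel] at hlow
      rw [hlow]
      congr 1
      · rw [hopE_vec, Pi.sub_apply, hm, pile_apply_self, Nat.add_sub_cancel, Finset.smul_sum]
        refine Finset.sum_congr rfl fun k hk => ?_
        rw [(lower_hop hij (Finset.mem_Icc.1 hk).1).2.2, smul_smul]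
        push_cast; rfl
      · simp [pile]

end Lowering

/-! ### Symmetries of the bulk density -/

section Bulk

variable {n : ℕ} {s : ℝ} {i j : Fin (n + 1)}

lemma sum_hop {t : Finset (Fin (n + 1))} (ht : i ∈ t ↔ j ∈ t) {m : Config n} {k : ℕ}
    (hk : k ≤ m i) : ∑ l ∈ t, (m - pile i k + pile j k) l = ∑ l ∈ t, m l := by
  have h : m - pile i k + pile j k + pile i k = m + pile j k := by
    rw [add_right_comm, sub_pile_add_pile hk]
  have h1 : ∑ l ∈ t, (m - pile i k + pile j k + pile i k) l = ∑ l ∈ t, (m + pile j k) l := by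
    rw [h]
  simp only [Pi.add_apply, Finset.sum_add_distrib, pile, Finset.sum_pi_single', ht] at h1 ⊢
  omega

lemma bulkE_commute_dg {g : Config n → ℝ}
    (hg : ∀ m k, k ≤ m i → g (m - pile i k + pile j k) = g m)
    (hg' : ∀ m k, k ≤ m j → g (m - pile j k + pile i k) = g m) :
    Commute (bulkE s i j) (dg g) := by
  have h1 := fun v => LinearMap.congr_fun (hopE_mul_dg (s := s) hg) v
  have h2 := fun v => LinearMap.congr_fun (hopE_mul_dg (s := s) hg') v
  have h3 := fun i v => LinearMap.congr_fun (dg_commute (fun m : Config n => harm s (m i)) g) v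
  simp only [Module.End.mul_apply] at h1 h2 h3
  refine LinearMap.ext fun v => ?_
  simp only [Module.End.mul_apply, bulkE_apply, map_sub, map_add, h1, h2, harmE, h3]

lemma bulkE_commute_raiseE_of_ne (s : ℝ) {l : Fin (n + 1)} (hli : l ≠ i) (hlj : l ≠ j) :
    Commute (bulkE s i j) (raiseE s l) := by
  have h1 := fun v => LinearMap.congr_fun (hopE_mul_raiseE_of_ne (i := i) (j := j) s hli hlj) v
  have h2 := fun v => LinearMap.congr_fun (hopE_mul_raiseE_of_ne (i := j) (j := i) s hlj hli) v
  have h3 := fun v => LinearMap.congr_fun (harmE_mul_raiseE_of_ne s hli.symm) v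
  have h4 := fun v => LinearMap.congr_fun (harmE_mul_raiseE_of_ne s hlj.symm) v
  simp only [Module.End.mul_apply] at h1 h2 h3 h4
  refine LinearMap.ext fun v => ?_
  simp only [Module.End.mul_apply, bulkE_apply, map_sub, map_add, h1, h2, h3, h4]

lemma bulkE_commute_lowerE_of_ne (s : ℝ) {l : Fin (n + 1)} (hli : l ≠ i) (hlj : l ≠ j) :
    Commute (bulkE s i j) (lowerE l) := by
  have h1 := fun v => LinearMap.congr_fun (hopE_mul_lowerE_of_ne (i := i) (j := j) s hli hlj) v
  have h2 := fun v => LinearMap.congr_fun (hopE_mul_lowerE_of_ne (i := j) (j := i) s hlj hli) v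
  have h3 := fun v => LinearMap.congr_fun (lowerE_mul_harmE_of_ne s hli.symm) v
  have h4 := fun v => LinearMap.congr_fun (lowerE_mul_harmE_of_ne s hlj.symm) v
  simp only [Module.End.mul_apply] at h1 h2 h3 h4
  refine LinearMap.ext fun v => ?_
  simp only [Module.End.mul_apply, bulkE_apply, map_sub, map_add, h1, h2, h3, h4]

/-- Both the diagonal part and the two hopping parts have defect `T_i + T_j`, and they enter with
opposite signs. -/
lemma bulkE_commute_raiseE_add (hs : 0 < s) (hij : i ≠ j) :
    Commute (bulkE s i j) (raiseE s i + raiseE s j) := by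
  have h1 := fun v => LinearMap.congr_fun (hopE_mul_raiseE hs hij) v
  have h2 := fun v => LinearMap.congr_fun (hopE_mul_raiseE hs hij.symm) v
  have h3 := fun v => LinearMap.congr_fun (harmE_mul_raiseE_of_ne s hij) v
  have h4 := fun v => LinearMap.congr_fun (harmE_mul_raiseE_of_ne s hij.symm) v
  have h5 := fun i v => LinearMap.congr_fun (harmE_mul_raiseE (n := n) hs i) v
  simp only [Module.End.mul_apply, LinearMap.add_apply, map_add] at h1 h2 h3 h4 h5
  refine LinearMap.ext fun v => ?_
  simp only [Module.End.mul_apply, bulkE_apply, LinearMap.add_apply, map_sub, map_add, h3, h4, h5]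
  have h1 := h1 v
  have h2 := h2 v
  rw [← sub_eq_zero] at h1 h2 ⊢
  have := congrArg₂ (fun x y => - x - y) h1 h2
  simp only [sub_zero, neg_zero] at this
  rw [← this]
  abel

lemma bulkE_commute_lowerE_add (hs : 0 < s) (hij : i ≠ j) :
    Commute (bulkE s i j) (lowerE i + lowerE j) := by
  have h1 := fun v => LinearMap.congr_fun (lowerE_mul_hopE hs hij) v
  have h2 := fun v => LinearMap.congr_fun (lowerE_mul_hopE hs hij.symm) v
  have h3 := fun v => LinearMap.congr_fun (lowerE_mul_harmE_of_ne s hij) v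
  have h4 := fun v => LinearMap.congr_fun (lowerE_mul_harmE_of_ne s hij.symm) v
  have h5 := fun i v => LinearMap.congr_fun (lowerE_mul_harmE (n := n) hs i) v
  simp only [Module.End.mul_apply, LinearMap.add_apply, map_add] at h1 h2 h3 h4 h5
  refine LinearMap.ext fun v => ?_
  simp only [Module.End.mul_apply, bulkE_apply, LinearMap.add_apply, map_sub, map_add, h3, h4, h5]
  have h1 := h1 v
  have h2 := h2 v
  rw [← sub_eq_zero] at h1 h2 ⊢
  have := congrArg₂ (fun x y => x + y) h1 h2
  simp only [add_zero] at this
  rw [← this]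
  abel

lemma sum_eq_pair_add {R : Type*} [AddCommMonoid R] (hij : i ≠ j) (f : Fin (n + 1) → R) :
    ∑ l, f l = (f i + f j) + ∑ l ∈ {i, j}ᶜ, f l := by
  rw [← Finset.sum_add_sum_compl {i, j}, Finset.sum_pair hij]

lemma bulkE_commute_sum_raiseE (hs : 0 < s) (hij : i ≠ j) :
    Commute (bulkE s i j) (∑ l, raiseE s l) := by
  rw [sum_eq_pair_add hij]
  refine (bulkE_commute_raiseE_add hs hij).add_right (Commute.sum_right _ _ _ fun l hl => ?_)
  simp only [Finset.mem_compl, Finset.mem_insert, Finset.mem_singleton, not_or] at hl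
  exact bulkE_commute_raiseE_of_ne s hl.1 hl.2

lemma bulkE_commute_sum_lowerE (hs : 0 < s) (hij : i ≠ j) :
    Commute (bulkE s i j) (∑ l, lowerE l) := by
  rw [sum_eq_pair_add hij]
  refine (bulkE_commute_lowerE_add hs hij).add_right (Commute.sum_right _ _ _ fun l hl => ?_)
  simp only [Finset.mem_compl, Finset.mem_insert, Finset.mem_singleton, not_or] at hl
  exact bulkE_commute_lowerE_of_ne s hl.1 hl.2

/-- The difference `S_+^{[i]} S_0^{[j]} - S_+^{[j]} S_0^{[i]}`. -/
def twistE (s : ℝ) (i j : Fin (n + 1)) : EndV n :=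
  raiseE s i * dg (fun m => (m j : ℝ) + s) - raiseE s j * dg fun m => (m i : ℝ) + s

lemma twistE_apply (s : ℝ) (i j : Fin (n + 1)) (v : Config n →₀ ℝ) :
    twistE s i j v = raiseE s i (dg (fun m => (m j : ℝ) + s) v) -
      raiseE s j (dg (fun m => (m i : ℝ) + s) v) := rfl

lemma twistE_swap (s : ℝ) (i j : Fin (n + 1)) (v : Config n →₀ ℝ) :
    twistE s j i v = -twistE s i j v := by
  rw [twistE_apply, twistE_apply, neg_sub]

lemma harmE_twistE (hs : 0 < s) (hij : i ≠ j) (v : Config n →₀ ℝ) :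
    harmE s i (twistE s i j v) =
      twistE s i j (harmE s i v) + shiftE i (dg (fun m => (m j : ℝ) + s) v) := by
  have h3 := fun v => LinearMap.congr_fun (harmE_mul_raiseE_of_ne s hij) v
  have h5 := fun v => LinearMap.congr_fun (harmE_mul_raiseE (n := n) hs i) v
  have h6 := fun g v => LinearMap.congr_fun (dg_commute (fun m : Config n => harm s (m i)) g) v
  simp only [Module.End.mul_apply, LinearMap.add_apply] at h3 h5 h6
  simp only [twistE_apply, map_sub, h5, h3]
  simp only [harmE, h6]
  abel

/-- At site `i` the diagonal defect `T_i (m_j + s)` and the hopping defect `T_i (m_i + s - m_j)` add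
up to `T_i (m_i + 2 s) = S_+^{[i]}`; site `j` enters with the opposite sign. -/
lemma bulkE_twistE (hs : 0 < s) (hij : i ≠ j) (v : Config n →₀ ℝ) :
    bulkE s i j (twistE s i j v) = twistE s i j (bulkE s i j v) + raiseE s i v - raiseE s j v := by
  have h1 := LinearMap.congr_fun (hopE_mul_twist hs hij) v
  have h2 := LinearMap.congr_fun (hopE_mul_twist hs hij.symm) v
  have h3 := harmE_twistE hs hij v
  have h4 := harmE_twistE hs hij.symm v
  rw [← twistE, Module.End.mul_apply, LinearMap.add_apply, Module.End.mul_apply,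
    Module.End.mul_apply] at h1 h2
  rw [twistE_swap s i j, twistE_swap s i j, map_neg, ← sub_eq_zero] at h2 h4
  rw [← sub_eq_zero] at h1 h3
  have e : ∀ (i j : Fin (n + 1)), raiseE s i v = shiftE i (dg (fun m => (m j : ℝ) + s) v) +
      shiftE i (dg (fun m => (m i : ℝ) + s - m j) v) := by
    intro i j
    rw [raiseE_eq, Module.End.mul_apply, ← map_add, ← LinearMap.add_apply, ← dg_add]
    congr 3
    ext m
    simp only [Pi.add_apply]
    ring
  rw [e i j, e j i, bulkE_apply, bulkE_apply]
  simp only [map_sub, map_add]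
  rw [← sub_eq_zero]
  have := congrArg₂ (fun x y => x + y) (congrArg₂ (fun x y => x - y) h3 h4)
    (congrArg₂ (fun x y => y - x) h1 h2)
  simp only [sub_zero, add_zero] at this
  rw [← this]
  abel

end Bulk

/-! ### The operator `Q_+` and its commutators -/

section Charge

variable {n : ℕ} {s : ℝ}

/-- The weights in `Q_+`. -/
def chargeWt (s : ℝ) (i : Fin (n + 1)) (m : Config n) : ℝ :=
  2 * s + m i + 2 * ∑ j ∈ Finset.Ioi i, ((m j : ℝ) + s)

/-- The operator `Q_+`. -/
def chargeE (n : ℕ) (s : ℝ) : EndV n := ∑ i, raiseE s i * dg (chargeWt s i)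

lemma mat_chargeE : mat (chargeE n s) = Qp n s := by
  have h : chargeE n s = s • ∑ i, raiseE s i + ∑ i, raiseE s i *
      (dg (fun m => (m i : ℝ) + s) + (2 : ℝ) • ∑ j ∈ Finset.Ioi i, dg fun m => (m j : ℝ) + s) := by
    rw [chargeE, Finset.smul_sum, ← Finset.sum_add_distrib]
    refine Finset.sum_congr rfl fun i _ => endV_ext fun m => ?_
    simp only [Module.End.mul_apply, LinearMap.add_apply, LinearMap.smul_apply, dg_vec,
      LinearMap.sum_apply, ← Finset.sum_smul, map_smul, map_add, chargeWt]
    module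
  rw [h, Qp, mat_add, mat_smul, mat_sum, mat_sum, SpTot]
  simp only [mat_mul, mat_add, mat_smul, mat_sum, mat_raiseE, mat_dg, S0_eq]

lemma hasDeg_chargeE : HasDeg 1 (chargeE n s) :=
  HasDeg.sum fun i _ => by simpa using (hasDeg_raiseE s i).mul (hasDeg_dg _)

/-- The constant term of `2 (S_0^{tot} + s)`. -/
def offset (n : ℕ) (s : ℝ) : ℝ := 2 * ((n : ℝ) + 1) * s + 2 * s

lemma two_mul_size_add_offset (s : ℝ) (m : Config n) :
    2 * (size m : ℝ) + offset n s = 2 * (∑ i, ((m i : ℝ) + s) + s) := by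
  simp [size, offset, Finset.sum_add_distrib]
  ring

lemma two_mul_size_add_offset' (s : ℝ) (m : Config n) :
    2 * (size m : ℝ) + offset n s =
      2 * ((m 0 : ℝ) + 2 * s + ∑ j ∈ Finset.Ioi (0 : Fin (n + 1)), ((m j : ℝ) + s)) := by
  have : (Finset.univ : Finset (Fin (n + 1))) = insert 0 (Finset.Ioi 0) := by
    ext l; simp [em]
  rw [two_mul_size_add_offset, this, Finset.sum_insert (by simp)]
  ring

lemma dg_mul_shiftE {f : Config n → ℝ} {i : Fin (n + 1)} (h : ∀ m, f (m + pile i 1) = f m) :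
    dg f * shiftE i = shiftE i * dg f :=
  endV_ext fun m => by simp [h]

/-- A weight at a site `i ≠ 0` involves only sites `j ≥ i`, hence never the first one, and those
terms commute with the shift. The term `i = 0` contributes `(m_0 + 1 + 2 s) + chargeWt s 0 m = c +
1`. -/
lemma chargeE_mul_shiftE : chargeE n s * shiftE 0 =
    shiftE 0 * chargeE n s + shiftE 0 ^ 2 * sizeHom n (offset n s) fun c => c + 1 := by
  have h : ∀ i ≠ (0 : Fin (n + 1)),
      raiseE s i * dg (chargeWt s i) * shiftE 0 = shiftE 0 * (raiseE s i * dg (chargeWt s i)) := by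
    intro i hi
    rw [mul_assoc, dg_mul_shiftE, ← mul_assoc, raiseE_mul_shiftE_of_ne s hi, mul_assoc]
    intro m
    have : ∀ j ∈ Finset.Ioi i, (((m + pile 0 1 : Config n) j : ℕ) : ℝ) + s = (m j : ℝ) + s := by
      intro j hj
      have hj0 : j ≠ 0 := (Fin.pos_of_ne_zero hi |>.trans (Finset.mem_Ioi.1 hj)).ne'
      simp [pile_apply_of_ne hj0]
    rw [chargeWt, chargeWt, Finset.sum_congr rfl this]
    simp [pile_apply_of_ne hi]
  have h0 : raiseE s 0 * dg (chargeWt s 0) * shiftE 0 =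
      shiftE 0 * (raiseE s 0 * dg (chargeWt s 0)) +
        shiftE 0 ^ 2 * sizeHom n (offset n s) fun c => c + 1 := by
    refine endV_ext fun m => ?_
    have : ∀ j ∈ Finset.Ioi (0 : Fin (n + 1)),
        (((m + pile 0 1 : Config n) j : ℕ) : ℝ) + s = (m j : ℝ) + s := by
      intro j hj
      simp [pile_apply_of_ne (Finset.mem_Ioi.1 hj).ne']
    simp only [sizeHom_apply, two_mul_size_add_offset', pow_two, Module.End.mul_apply,
      LinearMap.add_apply, shiftE_vec, dg_vec, map_smul, raiseE_vec]
    rw [chargeWt, chargeWt, Finset.sum_congr rfl this]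
    simp only [Pi.add_apply, pile_apply_self]
    push_cast
    module
  rw [chargeE, Finset.sum_mul, Finset.mul_sum, ← Finset.add_sum_erase _ _ (Finset.mem_univ 0),
    ← Finset.add_sum_erase _ (fun i => shiftE 0 * (raiseE s i * dg (chargeWt s i)))
      (Finset.mem_univ 0), h0,
    Finset.sum_congr rfl fun i hi => h i (Finset.ne_of_mem_erase hi), add_right_comm]

/-- By adjacency no site lies between `i` and `j`, so all other terms of `Q_+` depend on `m_i` and
`m_j` only through their sum and commute with the density. The terms at `i` and `j` split into a
commuting part and `twistE`, which alone produces the difference. -/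
lemma bulkE_chargeE (hs : 0 < s) {i j : Fin (n + 1)} (hij : i < j)
    (hadj : Finset.Ioi i = insert j (Finset.Ioi j)) (v : Config n →₀ ℝ) :
    bulkE s i j (chargeE n s v) =
      chargeE n s (bulkE s i j v) + raiseE s i v - raiseE s j v := by
  have hrest : Commute (bulkE s i j) (∑ l ∈ {i, j}ᶜ, raiseE s l * dg (chargeWt s l)) := by
    refine Commute.sum_right _ _ _ fun l hl => ?_
    simp only [Finset.mem_compl, Finset.mem_insert, Finset.mem_singleton, not_or] at hl
    have hmem : i ∈ Finset.Ioi l ↔ j ∈ Finset.Ioi l := by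
      simp only [Finset.mem_Ioi]
      refine ⟨fun h => h.trans hij, fun h => ?_⟩
      by_contra hil
      have : l ∈ Finset.Ioi i := Finset.mem_Ioi.2 (lt_of_le_of_ne (not_lt.1 hil) (Ne.symm hl.1))
      rw [hadj, Finset.mem_insert, Finset.mem_Ioi] at this
      rcases this with h' | h'
      · exact hl.2 h'
      · exact lt_asymm h h'
    refine (bulkE_commute_raiseE_of_ne s hl.1 hl.2).mul_right (bulkE_commute_dg ?_ ?_)
    · intro m k hk
      have := congrArg (Nat.cast : ℕ → ℝ) (sum_hop hmem hk)
      push_cast at this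
      simp only [chargeWt, Finset.sum_add_distrib, this]
      simp [pile_apply_of_ne hl.1, pile_apply_of_ne hl.2]
    · intro m k hk
      have := congrArg (Nat.cast : ℕ → ℝ) (sum_hop hmem.symm hk)
      push_cast at this
      simp only [chargeWt, Finset.sum_add_distrib, this]
      simp [pile_apply_of_ne hl.1, pile_apply_of_ne hl.2]
  -- The symmetric part of the two weights: `chargeWt s i = g + (m_j + s)` and `chargeWt s j = g -
  -- (m_i + s)`.
  set g : Config n → ℝ := fun m =>
    s + (∑ l ∈ {i, j}, (m l + s) + 2 * ∑ l ∈ Finset.Ioi j, ((m l : ℝ) + s)) with hg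
  have hgc : Commute (bulkE s i j) (dg g) := by
    have h1 : i ∉ Finset.Ioi j := by simp [hij.le]
    have h2 : j ∉ Finset.Ioi j := by simp
    refine bulkE_commute_dg ?_ ?_
    · intro m k hk
      have e1 := congrArg (Nat.cast : ℕ → ℝ) (sum_hop (i := i) (j := j) (t := {i, j}) (by simp) hk)
      have e2 := congrArg (Nat.cast : ℕ → ℝ)
        (sum_hop (t := Finset.Ioi j) (iff_of_false h1 h2) hk)
      push_cast at e1 e2
      simp only [hg, Finset.sum_add_distrib, e1, e2]
    · intro m k hk
      have e1 := congrArg (Nat.cast : ℕ → ℝ) (sum_hop (i := j) (j := i) (t := {i, j}) (by simp) hk)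
      have e2 := congrArg (Nat.cast : ℕ → ℝ)
        (sum_hop (t := Finset.Ioi j) (iff_of_false h2 h1) hk)
      push_cast at e1 e2
      simp only [hg, Finset.sum_add_distrib, e1, e2]
  have hpair : raiseE s i * dg (chargeWt s i) + raiseE s j * dg (chargeWt s j) =
      (raiseE s i + raiseE s j) * dg g + twistE s i j := by
    refine endV_ext fun m => ?_
    simp only [LinearMap.add_apply, Module.End.mul_apply, twistE_apply, dg_vec, map_smul, chargeWt,
      hg, hadj, Finset.sum_pair hij.ne]
    rw [Finset.sum_insert (by simp)]
    module
  have h1 := LinearMap.congr_fun ((bulkE_commute_raiseE_add hs hij.ne).mul_right hgc).eq v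
  have h2 := LinearMap.congr_fun hrest.eq v
  rw [Module.End.mul_apply (bulkE s i j), Module.End.mul_apply _ (bulkE s i j)] at h1 h2
  rw [chargeE, sum_eq_pair_add hij.ne, hpair]
  simp only [LinearMap.add_apply _ _ v, LinearMap.add_apply _ _ (bulkE s i j v), map_add]
  rw [h1, h2, bulkE_twistE hs hij.ne]
  abel

/-- The diagonal Hamiltonian. -/
def hamDiagE (n : ℕ) (s : ℝ) : EndV n :=
  harmE s 0 + ∑ i : Fin n, bulkE s i.castSucc i.succ + harmE s (Fin.last n)

lemma hasDeg_hamDiagE : HasDeg 0 (hamDiagE n s) :=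
  ((hasDeg_dg _).add (HasDeg.sum fun _ _ => hasDeg_bulkE s _ _)).add (hasDeg_dg _)

lemma Ioi_castSucc (i : Fin n) :
    Finset.Ioi i.castSucc = insert i.succ (Finset.Ioi i.succ) := by
  ext l
  simp only [Finset.mem_Ioi, Finset.mem_insert, Fin.lt_def, Fin.ext_iff, Fin.val_castSucc,
    Fin.val_succ]
  omega

lemma harmE_mul_chargeE (hs : 0 < s) (i : Fin (n + 1)) :
    harmE s i * chargeE n s = chargeE n s * harmE s i + shiftE i * dg (chargeWt s i) := by
  have h : ∀ l ≠ i, harmE s i * (raiseE s l * dg (chargeWt s l)) =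
      raiseE s l * dg (chargeWt s l) * harmE s i := by
    intro l hl
    rw [← mul_assoc, harmE_mul_raiseE_of_ne s hl.symm, mul_assoc, mul_assoc, harmE, dg_commute]
  have h0 : harmE s i * (raiseE s i * dg (chargeWt s i)) =
      raiseE s i * dg (chargeWt s i) * harmE s i + shiftE i * dg (chargeWt s i) := by
    rw [← mul_assoc, harmE_mul_raiseE hs, add_mul, mul_assoc, mul_assoc, harmE, dg_commute]
  rw [chargeE, Finset.sum_mul, Finset.mul_sum, ← Finset.add_sum_erase _ _ (Finset.mem_univ i),
    ← Finset.add_sum_erase _ (fun l => raiseE s l * dg (chargeWt s l) * harmE s i)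
      (Finset.mem_univ i), h0,
    Finset.sum_congr rfl fun l hl => h l (Finset.ne_of_mem_erase hl), add_right_comm]

/-- The bulk telescopes to `S_+` at the first site minus `S_+` at the last. The last boundary
cancels the latter, since its weight sum is empty; the first boundary completes the former to `T_1
c`. -/
lemma hamDiagE_mul_chargeE (hs : 0 < s) : hamDiagE n s * chargeE n s =
    chargeE n s * hamDiagE n s + shiftE 0 * sizeHom n (offset n s) fun c => c := by
  refine LinearMap.ext fun v => ?_
  have h0 := LinearMap.congr_fun (harmE_mul_chargeE (n := n) hs 0) v
  have hN := LinearMap.congr_fun (harmE_mul_chargeE (n := n) hs (Fin.last n)) v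
  have hb : ∑ i : Fin n, bulkE s i.castSucc i.succ (chargeE n s v) =
      ∑ i : Fin n, chargeE n s (bulkE s i.castSucc i.succ v) +
        (raiseE s 0 v - raiseE s (Fin.last n) v) := by
    have h1 := Fin.sum_univ_castSucc fun i : Fin (n + 1) => raiseE s i v
    rw [Fin.sum_univ_succ, ← sub_eq_sub_iff_add_eq_add] at h1
    rw [Finset.sum_congr rfl fun i _ => bulkE_chargeE hs i.castSucc_lt_succ (Ioi_castSucc i) v]
    simp only [add_sub_assoc, Finset.sum_add_distrib, Finset.sum_sub_distrib]
    congr 1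
    rw [← neg_sub (∑ i : Fin n, raiseE s i.succ v), ← neg_sub (raiseE s (Fin.last n) v)]
    congr 1
    rw [sub_eq_sub_iff_add_eq_add] at h1 ⊢
    rw [add_comm, h1, add_comm]
  have hlast : shiftE (Fin.last n) * dg (chargeWt s (Fin.last n)) = raiseE s (Fin.last n) := by
    rw [raiseE_eq]
    congr 2
    ext m
    have : Finset.Ioi (Fin.last n) = ∅ := by ext l; simp [Fin.le_last]
    rw [chargeWt, this]
    simp [add_comm]
  have hfirst : raiseE s 0 + shiftE 0 * dg (chargeWt s 0) =
      shiftE 0 * sizeHom n (offset n s) fun c => c := by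
    rw [raiseE_eq, ← mul_add, ← dg_add, sizeHom_apply]
    congr 2
    ext m
    rw [two_mul_size_add_offset', Pi.add_apply, chargeWt]
    ring
  rw [hlast] at hN
  rw [← hfirst]
  simp only [Module.End.mul_apply, LinearMap.add_apply] at h0 hN
  simp only [Module.End.mul_apply, LinearMap.add_apply, hamDiagE, LinearMap.sum_apply, map_add,
    map_sum, h0, hN, hb]
  abel

end Charge

/-! ### The digamma function and the diagonal boundary terms -/

section DiagonalBoundary

variable {n : ℕ} {s : ℝ}

/-- The logarithmic derivative of `Γ(x + 1) = x Γ(x)`. -/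
lemma psi_add_one {x : ℝ} (hx : 0 < x) : psi (x + 1) = psi x + 1 / x := by
  have hd : ∀ y : ℝ, 0 < y → DifferentiableAt ℝ Real.Gamma y := fun y hy =>
    Real.differentiableAt_Gamma fun m => by
      have : (0 : ℝ) ≤ m := Nat.cast_nonneg m
      linarith
  have h1 : (fun y => Real.Gamma (y + 1)) =ᶠ[nhds x] fun y => y * Real.Gamma y := by
    filter_upwards [lt_mem_nhds hx] with y hy
    exact Real.Gamma_add_one hy.ne'
  have h2 : logDeriv (fun y => Real.Gamma (y + 1)) x = logDeriv Real.Gamma (x + 1) := by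
    rw [logDeriv_apply, logDeriv_apply, deriv_comp_add_const]
  have h3 : logDeriv (fun y => y * Real.Gamma y) x = 1 / x + logDeriv Real.Gamma x := by
    rw [logDeriv_mul (f := fun y => y) x hx.ne' (Real.Gamma_pos_of_pos hx).ne'
      differentiableAt_id (hd x hx)]
    simp [logDeriv_apply]
  rw [psi, psi, ← h2, logDeriv_apply, h1.deriv_eq, h1.eq_of_nhds, ← logDeriv_apply, h3, add_comm]

lemma psi_sub_psi (hs : 0 < s) (m : ℕ) : psi ((m : ℝ) + s + s) - psi (2 * s) = harm s m := by
  induction m with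
  | zero => simp [two_mul]
  | succ m ih =>
    have h : (0 : ℝ) < (m : ℝ) + s + s := by positivity
    have h2 := harm_succ hs m
    have h3 : (m : ℝ) + 2 * s ≠ 0 := by positivity
    rw [show ((m + 1 : ℕ) : ℝ) + s + s = (m : ℝ) + s + s + 1 by push_cast; ring, psi_add_one h,
      add_sub_right_comm, ih, ← mul_right_inj' h3, h2,
      show (m : ℝ) + s + s = m + 2 * s by ring]
    field_simp

lemma bdryDiag_eq (hs : 0 < s) (i : Fin (n + 1)) : bdryDiag s i = mat (harmE s i) := by
  rw [bdryDiag, Op.diagFun, harmE, mat_dg]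
  congr 1
  ext m
  simp [S0_eq, psi_sub_psi hs]

/-- The bulk Hamiltonian. -/
def bulkSumE (n : ℕ) (s : ℝ) : EndV n := ∑ i : Fin n, bulkE s i.castSucc i.succ

lemma mat_bulkSumE : mat (bulkSumE n s) = bulkSum n s := by
  simp only [bulkSumE, mat_sum, mat_bulkE, bulkSum]

lemma hasDeg_bulkSumE : HasDeg 0 (bulkSumE n s) := HasDeg.sum fun _ _ => hasDeg_bulkE s _ _

lemma mat_hamDiagE (hs : 0 < s) : mat (hamDiagE n s) = hamDiag n s := by
  rw [hamDiagE, ← bulkSumE, mat_add, mat_add, mat_bulkSumE, hamDiag, bdryDiag_eq hs,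
    bdryDiag_eq hs]

end DiagonalBoundary

/-! ### The transformation `𝓦` as a graded series -/

section Graded

variable {n : ℕ} {s : ℝ}

lemma graded_logSer {B T : EndV n} (hB : HasDeg 0 B) (hT : HasDeg 1 T) (x : ℝ) :
    Graded 1 (logSer x B T) := by
  intro k
  rw [logSer, PowerSeries.coeff_mk]
  split_ifs with h
  · simpa [h] using hB
  · exact (hT.pow k).smul _

lemma graded_wSer {Q : EndV n} (hQ : HasDeg 1 Q) (θ b : ℝ) : Graded 1 (wSer θ Q (sizeHom n b)) := by
  intro k
  rw [wSer, PowerSeries.coeff_mk]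
  have h := (hQ.pow k).mul (hasDeg_dg fun m : Config n => (rising (2 * (size m : ℝ) + b) k)⁻¹)
  rw [add_zero] at h
  exact h.smul _

lemma offset_pos (hs : 0 < s) : 0 < offset n s := by unfold offset; positivity

/-- The series `𝓦`. -/
def wE (n : ℕ) (s βL βR : ℝ) : PowerSeries (EndV n) :=
  wSer (dens βL - dens βR) (chargeE n s) (sizeHom n (offset n s))

lemma graded_wE (s βL βR : ℝ) : Graded 1 (wE n s βL βR) := graded_wSer hasDeg_chargeE _ _

/-- On every configuration `c = 2 (S_0^{tot} + s)` is positive, so the Gamma quotient is `1 / (c (c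
+ 1) ⋯ (c + k - 1))`. -/
lemma WTerm_eq (hs : 0 < s) (βL βR : ℝ) (k : ℕ) :
    WTerm n s βL βR k = mat (PowerSeries.coeff k (wE n s βL βR)) := by
  have h : Op.diagFun (fun x => Real.Gamma (2 * (x + s)) / Real.Gamma (k + 2 * (x + s)))
      (S0Tot n s) = mat (sizeHom n (offset n s) fun c => (rising c k)⁻¹) := by
    rw [Op.diagFun, sizeHom_apply, mat_dg]
    congr 1
    ext m
    have e : S0Tot n s m m = ∑ i, ((m i : ℝ) + s) := by
      simp only [S0Tot, S0_eq, Matrix.sum_apply, Matrix.diagonal_apply_eq]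
    have hc : 0 < 2 * (size m : ℝ) + offset n s := by
      have := offset_pos (n := n) hs
      positivity
    rw [e, ← two_mul_size_add_offset, add_comm (k : ℝ), Gamma_add_nat hc,
      div_mul_cancel_right₀ (Real.Gamma_pos_of_pos hc).ne']
  rw [WTerm, h, wE, wSer, PowerSeries.coeff_mk, ← mat_chargeE, pow_mat, ← mat_smul, ← mat_mul,
    ← mat_smul, smul_mul_assoc, smul_smul, div_eq_mul_inv]

lemma W_eq (hs : 0 < s) (βL βR : ℝ) : W n s βL βR = total (wE n s βL βR) := by
  ext p m
  exact tsum_congr fun k => by rw [WTerm_eq hs]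

lemma logSer_mul_wE (hs : 0 < s) (βL βR : ℝ) :
    logSer (dens βL - dens βR) (hamDiagE n s) (shiftE 0) * wE n s βL βR =
      wE n s βL βR * PowerSeries.C (hamDiagE n s) := by
  have h1 : ∀ {A : EndV n}, HasDeg 1 A → ∀ f : ℝ → ℝ, sizeHom n (offset n s) f * A =
      A * sizeHom n (offset n s) fun c => f (c + 2) := fun hA f => by
    simpa using sizeHom_mul (d := 1) (by simpa using hA) (offset n s) f
  refine logSer_mul_wSer (h1 (hasDeg_shiftE 0)) (h1 hasDeg_chargeE) chargeE_mul_shiftE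
    (hamDiagE_mul_chargeE hs) (fun f => ?_) (fun f g hfg => ?_) _
  · simpa using sizeHom_mul (d := 0) (by simpa using hasDeg_hamDiagE) (offset n s) f
  · rw [sizeHom_apply, sizeHom_apply]
    congr 1
    ext m
    refine hfg _ ?_
    have := offset_pos (n := n) hs
    positivity

lemma constantCoeff_wE (s βL βR : ℝ) : PowerSeries.constantCoeff (wE n s βL βR) = 1 := by
  rw [← PowerSeries.coeff_zero_eq_constantCoeff_apply, wE, wSer, PowerSeries.coeff_mk]
  simp only [rising_zero, inv_one, pow_zero, one_mul, Nat.factorial_zero, Nat.cast_one, div_one,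
    one_smul]
  exact map_one (sizeHom n (offset n s))

end Graded

/-! ### Conjugation by the exponential of `S_+^{tot}` -/

section Rotation

variable {n : ℕ} {s : ℝ}

/-- `S_+^{tot}`. -/
def raiseTotE (n : ℕ) (s : ℝ) : EndV n := ∑ i, raiseE s i

/-- `S_-^{tot}`. -/
def lowerTotE (n : ℕ) : EndV n := ∑ i, lowerE i

lemma mat_raiseTotE : mat (raiseTotE n s) = SpTot n s := by
  simp only [raiseTotE, mat_sum, mat_raiseE, SpTot]

lemma mat_lowerTotE : mat (lowerTotE n) = SmTot n := by
  simp only [lowerTotE, mat_sum, mat_lowerE, SmTot]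

lemma hasDeg_raiseTotE : HasDeg 1 (raiseTotE n s) := HasDeg.sum fun _ _ => hasDeg_raiseE s _

lemma hasDeg_lowerTotE : HasDeg (-1) (lowerTotE n) := HasDeg.sum fun _ _ => hasDeg_lowerE _

lemma raiseTotE_commute_bulkSumE (hs : 0 < s) : Commute (raiseTotE n s) (bulkSumE n s) :=
  Commute.sum_right _ _ _ fun i _ => (bulkE_commute_sum_raiseE hs i.castSucc_lt_succ.ne).symm

lemma lowerTotE_commute_bulkSumE (hs : 0 < s) : Commute (lowerTotE n) (bulkSumE n s) :=
  Commute.sum_right _ _ _ fun i _ => (bulkE_commute_sum_lowerE hs i.castSucc_lt_succ.ne).symm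

lemma harmE_mul_raiseTotE (hs : 0 < s) (i : Fin (n + 1)) :
    harmE s i * raiseTotE n s = raiseTotE n s * harmE s i + shiftE i := by
  rw [raiseTotE, Finset.sum_mul, Finset.mul_sum, ← Finset.add_sum_erase _ _ (Finset.mem_univ i),
    ← Finset.add_sum_erase _ (fun l => raiseE s l * harmE s i) (Finset.mem_univ i),
    harmE_mul_raiseE hs, Finset.sum_congr rfl fun l hl =>
      harmE_mul_raiseE_of_ne s (Finset.ne_of_mem_erase hl).symm, add_right_comm]

lemma raiseTotE_mul_shiftE (s : ℝ) (i : Fin (n + 1)) :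
    raiseTotE n s * shiftE i = shiftE i * raiseTotE n s + shiftE i ^ 2 := by
  rw [raiseTotE, Finset.sum_mul, Finset.mul_sum, ← Finset.add_sum_erase _ _ (Finset.mem_univ i),
    ← Finset.add_sum_erase _ (fun l => shiftE i * raiseE s l) (Finset.mem_univ i),
    raiseE_mul_shiftE, Finset.sum_congr rfl fun l hl =>
      raiseE_mul_shiftE_of_ne s (Finset.ne_of_mem_erase hl), add_right_comm]

lemma expSer_mul_C_harmE (hs : 0 < s) (x : ℝ) (i : Fin (n + 1)) :
    expSer x (raiseTotE n s) * PowerSeries.C (harmE s i) * expSer (-x) (raiseTotE n s) =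
      logSer x (harmE s i) (shiftE i) := by
  rw [expSer_mul_C (harmE_mul_raiseTotE hs i) (raiseTotE_mul_shiftE s i), mul_assoc,
    expSer_mul_expSer, add_neg_cancel, expSer_zero, mul_one]

/-- The series of the Hamiltonian `H'`. -/
def ham'E (n : ℕ) (s βL βR : ℝ) : PowerSeries (EndV n) :=
  logSer (dens βL) (harmE s 0) (shiftE 0) + PowerSeries.C (bulkSumE n s) +
    logSer (dens βR) (harmE s (Fin.last n)) (shiftE (Fin.last n))

lemma graded_ham'E (s βL βR : ℝ) : Graded 1 (ham'E n s βL βR) :=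
  ((graded_logSer (hasDeg_dg _) (hasDeg_shiftE _) _).add (Graded.C hasDeg_bulkSumE)).add
    (graded_logSer (hasDeg_dg _) (hasDeg_shiftE _) _)

lemma logSer_add (x : ℝ) {R : Type*} [Semiring R] [Algebra ℝ R] (A B T : R) :
    logSer x A T + PowerSeries.C B = logSer x (A + B) T := by
  ext1 k
  rcases k with _ | k <;> simp [logSer]

/-- Each boundary logarithm is itself a conjugate `e^{x S_+} h_i e^{-x S_+}`, so the exponents
simply add: the right boundary becomes diagonal and the left one keeps the parameter `ρ_L - ρ_R`. -/
lemma conj_ham'E (hs : 0 < s) (βL βR : ℝ) :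
    expSer (-dens βR) (raiseTotE n s) * ham'E n s βL βR * expSer (dens βR) (raiseTotE n s) =
      logSer (dens βL - dens βR) (hamDiagE n s) (shiftE 0) := by
  set S := raiseTotE n s
  set x := dens βL
  set y := dens βR
  have h1 : expSer (-y) S * logSer x (harmE s 0) (shiftE 0) * expSer y S =
      logSer (x - y) (harmE s 0) (shiftE 0) := by
    rw [← expSer_mul_C_harmE hs, ← expSer_mul_C_harmE hs, ← mul_assoc, ← mul_assoc,
      expSer_mul_expSer, mul_assoc _ (expSer (-x) S), expSer_mul_expSer]
    congr 3 <;> ring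
  have h2 : expSer (-y) S * PowerSeries.C (bulkSumE n s) * expSer y S =
      PowerSeries.C (bulkSumE n s) := by
    rw [expSer_mul_C_of_commute (raiseTotE_commute_bulkSumE hs), mul_assoc, expSer_mul_expSer,
      neg_add_cancel, expSer_zero, mul_one]
  have h3 : expSer (-y) S * logSer y (harmE s (Fin.last n)) (shiftE (Fin.last n)) * expSer y S =
      PowerSeries.C (harmE s (Fin.last n)) := by
    rw [← expSer_mul_C_harmE hs, ← mul_assoc, ← mul_assoc, expSer_mul_expSer, mul_assoc _ _
      (expSer y S), expSer_mul_expSer, neg_add_cancel, expSer_zero, mul_one, one_mul]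
  rw [ham'E, mul_add, mul_add, add_mul, add_mul, h1, h2, h3, logSer_add, logSer_add]
  rfl

end Rotation

lemma hasSum_congr {ι : Type*} {f g : ι → ℝ} {a : ℝ} (h : ∀ i, f i = g i) :
    HasSum f a ↔ HasSum g a := by
  rw [funext h]

/-! ### Binomial sums for one boundary site -/

section SingleSite

variable {s : ℝ}

lemma descFactorial_mul_choose (p d k : ℕ) :
    (p + d).descFactorial k * (p + d - k).choose p = (p + d).choose p * d.descFactorial k := by
  induction k with
  | zero => simp
  | succ k ih =>
    rw [Nat.descFactorial_succ, Nat.descFactorial_succ]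
    rcases Nat.lt_or_ge k d with h | h
    · obtain ⟨e, rfl⟩ := Nat.exists_eq_add_of_lt h
      have h1 := Nat.choose_mul_succ_eq (p + e) p
      have e1 : p + (k + e + 1) - k = p + e + 1 := by omega
      have e2 : p + (k + e + 1) - (k + 1) = p + e := by omega
      have e3 : p + e + 1 - p = e + 1 := by omega
      have e4 : k + e + 1 - k = e + 1 := by omega
      rw [e1] at ih ⊢
      rw [e2, e4]
      rw [e3] at h1
      calc (p + e + 1) * (p + (k + e + 1)).descFactorial k * (p + e).choose p
          = (p + (k + e + 1)).descFactorial k * ((p + e).choose p * (p + e + 1)) := by ring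
        _ = (p + (k + e + 1)).descFactorial k * (p + e + 1).choose p * (e + 1) := by rw [h1]; ring
        _ = _ := by rw [ih]; ring
    · rw [Nat.sub_eq_zero_of_le h, zero_mul, mul_zero]
      rcases Nat.lt_or_ge (p + d) (k + 1) with h' | h'
      · have := Nat.descFactorial_of_lt h'
        rw [Nat.descFactorial_succ] at this
        rw [this, zero_mul]
      · rw [Nat.choose_eq_zero_of_lt (by omega), mul_zero]

/-- The denominators of `rate` depend only on `m - k + 2 s`, so removing `p` particles amounts to
raising the spin by `p / 2`; the numerators are matched by `descFactorial_mul_choose`. -/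
lemma phi_mul_choose (hs : 0 < s) (p d k : ℕ) :
    phi s (k + 1) (p + d) * ((p + d - (k + 1)).choose p : ℝ) =
      ((p + d).choose p : ℝ) * phi (s + p / 2) (k + 1) d := by
  have hs' : 0 < s + (p : ℝ) / 2 := by positivity
  have h1 := mul_phi hs k (p + d)
  have h2 := mul_phi hs' k d
  have h3 : ((k : ℝ) + 1) ≠ 0 := by positivity
  have h4 := congrArg (Nat.cast : ℕ → ℝ) (descFactorial_mul_choose p d (k + 1))
  have e : ((p + d : ℕ) : ℝ) - (k + 1 : ℕ) + 2 * s = d - (k + 1 : ℕ) + 2 * (s + p / 2) := by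
    push_cast; ring
  rw [← mul_right_inj' h3, ← mul_assoc, h1, mul_left_comm, h2, rate, rate, e, div_mul_eq_mul_div,
    ← mul_div_assoc]
  push_cast at h4 ⊢
  rw [h4]

lemma harm_shift (hs : 0 < s) (p d : ℕ) :
    harm (s + p / 2) d = harm s (p + d) - harm s p := by
  have hs' : 0 < s + (p : ℝ) / 2 := by positivity
  induction d with
  | zero => simp
  | succ d ih =>
    have h1 := harm_succ hs' d
    have h2 := harm_succ hs (p + d)
    have h3 : (d : ℝ) + 2 * (s + p / 2) ≠ 0 := by positivity
    rw [← add_assoc, ← mul_right_inj' h3, h1, ih]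
    push_cast at h2
    linear_combination -h2

lemma sum_phi_mul_choose (hs : 0 < s) (m p : ℕ) :
    ∑ k ∈ Finset.Icc 1 m, phi s k m * ((m - k).choose p : ℝ) =
      (m.choose p : ℝ) * (harm s m - harm s p) := by
  rcases Nat.lt_or_ge m p with h | h
  · rw [Nat.choose_eq_zero_of_lt h, Finset.sum_eq_zero]
    · simp
    · intro k _
      rw [Nat.choose_eq_zero_of_lt (by omega)]; simp
  · obtain ⟨d, rfl⟩ := Nat.exists_eq_add_of_le h
    rw [← harm_shift hs, harm, Finset.mul_sum, sum_Icc_one, sum_Icc_one,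
      Finset.sum_congr rfl fun k _ => phi_mul_choose hs p d k]
    refine (Finset.sum_subset (Finset.range_mono (by omega)) fun k _ hk => ?_).symm
    rw [phi, if_neg (by simp at hk; omega), mul_zero]

/-- In generating functions over `p` this is `1 - β (1 + z) = (1 - β) (1 - ρ z)` inside `-(1 + z)^m
log`. The proof is by Pascal's rule in `m`, with the negative binomial series at `m = 0`. -/
lemma hasSum_log_mul_choose {β : ℝ} (hβ : β ∈ Set.Ioo (0 : ℝ) 1) (m p : ℕ) :
    HasSum (fun k : ℕ => β ^ (k + 1) / ((k + 1 : ℕ) : ℝ) * ((m + (k + 1)).choose p : ℝ))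
      ((m.choose p : ℝ) * (∑' k : ℕ, β ^ (k + 1) / ((k + 1 : ℕ) : ℝ)) +
        ∑ j ∈ Finset.Icc 1 p, dens β ^ j / (j : ℝ) * (m.choose (p - j) : ℝ)) := by
  have hn : ‖β‖ < 1 := by rw [Real.norm_eq_abs, abs_of_pos hβ.1]; exact hβ.2
  have hL : Summable fun k : ℕ => β ^ (k + 1) / ((k + 1 : ℕ) : ℝ) := by
    have := (Real.hasSum_pow_div_log_of_abs_lt_one (x := β) (by rwa [← Real.norm_eq_abs])).summable
    simpa using this
  have h1β : 1 - β ≠ 0 := by linarith [hβ.2]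
  induction m generalizing p with
  | zero =>
    rcases p with _ | q
    · simpa using hL.hasSum
    · have hg := (hasSum_choose_mul_geometric_of_norm_lt_one q hn).mul_left
        (β ^ (q + 1) / ((q : ℝ) + 1))
      have hq : ((q : ℝ) + 1) ≠ 0 := by positivity
      have hval : β ^ (q + 1) / ((q : ℝ) + 1) * (1 / (1 - β) ^ (q + 1)) =
          ((0 : ℕ).choose (q + 1) : ℝ) * (∑' k : ℕ, β ^ (k + 1) / ((k + 1 : ℕ) : ℝ)) +
          ∑ j ∈ Finset.Icc 1 (q + 1), dens β ^ j / (j : ℝ) *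
            ((0 : ℕ).choose (q + 1 - j) : ℝ) := by
        rw [Nat.choose_zero_succ, Nat.cast_zero, zero_mul, zero_add,
          Finset.sum_eq_single (q + 1)]
        · rw [dens, div_pow, Nat.sub_self, Nat.choose_self]
          push_cast
          field_simp
        · intro j hj hne
          have := Finset.mem_Icc.1 hj
          rw [Nat.choose_eq_zero_of_lt (by omega)]; simp
        · intro h; simp at h
      rw [← hval]
      -- The first `q` terms vanish because `(k + 1).choose (q + 1) = 0` for `k < q`.
      refine (hasSum_nat_add_iff' q).1 ?_
      rw [Finset.sum_eq_zero, sub_zero]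
      · refine (hasSum_congr fun k => ?_).1 hg
        have h := congrArg (Nat.cast : ℕ → ℝ) (Nat.add_one_mul_choose_eq (k + q) q)
        have hk : ((k : ℝ) + q + 1) ≠ 0 := by positivity
        push_cast at h
        rw [zero_add, pow_add β q 1, pow_add β (k + q) 1, pow_add β k q]
        push_cast
        rw [div_mul_eq_mul_div, div_mul_eq_mul_div, div_eq_div_iff hq hk]
        linear_combination (β ^ k * β ^ q * β) * h
      · intro k hk
        have := Finset.mem_range.1 hk
        rw [Nat.choose_eq_zero_of_lt (by omega)]; simp
  | succ m ih =>
    rcases p with _ | q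
    · simpa using hL.hasSum
    · have h := (ih q).add (ih (q + 1))
      have e1 : ∀ k : ℕ, β ^ (k + 1) / ((k + 1 : ℕ) : ℝ) * ((m + 1 + (k + 1)).choose (q + 1) : ℝ) =
          β ^ (k + 1) / ((k + 1 : ℕ) : ℝ) * ((m + (k + 1)).choose q : ℝ) +
          β ^ (k + 1) / ((k + 1 : ℕ) : ℝ) * ((m + (k + 1)).choose (q + 1) : ℝ) := by
        intro k
        rw [show m + 1 + (k + 1) = (m + (k + 1)) + 1 by ring, Nat.choose_succ_succ]
        push_cast; ring
      have e2 : ∀ j ∈ Finset.Icc 1 q, dens β ^ j / (j : ℝ) * ((m + 1).choose (q + 1 - j) : ℝ) =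
          dens β ^ j / (j : ℝ) * (m.choose (q - j) : ℝ) +
          dens β ^ j / (j : ℝ) * (m.choose (q + 1 - j) : ℝ) := by
        intro j hj
        have := (Finset.mem_Icc.1 hj).2
        rw [show q + 1 - j = (q - j) + 1 by omega, Nat.choose_succ_succ]
        push_cast; ring
      simp only [e1]
      convert h using 1
      rw [Finset.sum_Icc_succ_top (by omega), Finset.sum_Icc_succ_top (by omega),
        Finset.sum_congr rfl e2, Finset.sum_add_distrib, Nat.choose_succ_succ]
      simp
      ring

/-- The divergent-looking constant `L` drops out, and `h_s` moves from the column index `m` to the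
row index `p`. -/
lemma bdry_single_site (hs : 0 < s) (x L : ℝ) (m p : ℕ) :
    (harm s m + L) * (m.choose p : ℝ) - ∑ k ∈ Finset.Icc 1 m, phi s k m * ((m - k).choose p : ℝ) -
      ((m.choose p : ℝ) * L + ∑ j ∈ Finset.Icc 1 p, x ^ j / (j : ℝ) * (m.choose (p - j) : ℝ)) =
    harm s p * (m.choose p : ℝ) -
      ∑ j ∈ Finset.Icc 1 p, x ^ j / (j : ℝ) * (m.choose (p - j) : ℝ) := by
  rw [sum_phi_mul_choose hs]
  ring

end SingleSite

/-! ### The entries of the exponential of `S_-^{tot}` -/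

section ExpLower

variable {n : ℕ}

/-- The entries of `e^{S_-^{tot}}`. -/
def chooseOp (p m : Config n) : ℝ := ∏ j, ((m j).choose (p j) : ℝ)

lemma chooseOp_eq (i : Fin (n + 1)) {p m p' m' : Config n} (hp : ∀ j ≠ i, p' j = p j)
    (hm : ∀ j ≠ i, m' j = m j) : chooseOp p' m' =
      ((m' i).choose (p' i) : ℝ) * ∏ j ∈ Finset.univ.erase i, ((m j).choose (p j) : ℝ) := by
  rw [chooseOp, ← Finset.mul_prod_erase _ _ (Finset.mem_univ i)]
  congr 1
  refine Finset.prod_congr rfl fun j hj => ?_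
  rw [hp j (Finset.ne_of_mem_erase hj), hm j (Finset.ne_of_mem_erase hj)]

lemma chooseOp_eq_zero {p m : Config n} {i : Fin (n + 1)} (h : m i < p i) : chooseOp p m = 0 :=
  Finset.prod_eq_zero (Finset.mem_univ i) (by simp [Nat.choose_eq_zero_of_lt h])

lemma exists_lt_of_size_le {p m : Config n} (h : size m ≤ size p) (hne : p ≠ m) :
    ∃ i, m i < p i := by
  by_contra! hle
  have h1 : size p ≤ size m := Finset.sum_le_sum fun i _ => hle i
  have h2 := (Finset.sum_eq_sum_iff_of_le fun i _ => hle i).1 (le_antisymm h1 h)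
  exact hne (funext fun i => h2 i (Finset.mem_univ i))

lemma mul_chooseOp_sub (p m : Config n) (i : Fin (n + 1)) :
    (m i : ℝ) * chooseOp p (m - pile i 1) = ((m i : ℝ) - p i) * chooseOp p m := by
  rw [chooseOp_eq i (p := p) (m := m) (fun _ _ => rfl)
      (fun j hj => by simp [pile_apply_of_ne hj]),
    chooseOp_eq i (p := p) (m := m) (fun _ _ => rfl) (fun _ _ => rfl), Pi.sub_apply,
    pile_apply_self, ← mul_assoc, ← mul_assoc]
  congr 1
  rcases m i with _ | M
  · rcases p i with _ | P <;> simp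
  · have h := congrArg (Nat.cast : ℕ → ℝ) (Nat.choose_mul_succ_eq M (p i))
    rw [Nat.add_sub_cancel]
    rcases Nat.lt_or_ge (M + 1) (p i) with h' | h'
    · simp [Nat.choose_eq_zero_of_lt h', Nat.choose_eq_zero_of_lt (show M < p i by omega)]
    · push_cast [h'] at h ⊢
      linarith

/-- Induction on `k`: removing a particle at site `i` multiplies the product of binomials by `(m_i -
p_i) / m_i`, and the differences `m_i - p_i` sum to the number of steps left. -/
lemma lowerTotE_pow_vec (p : Config n) (k : ℕ) (m : Config n) (h : size m = size p + k) :
    (lowerTotE n ^ k) (vec m) p = (k ! : ℝ) * chooseOp p m := by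
  induction k generalizing m with
  | zero =>
    by_cases hpm : p = m
    · subst hpm; simp [chooseOp]
    · obtain ⟨i, hi⟩ := exists_lt_of_size_le (by omega) hpm
      simp [vec_of_ne hpm, chooseOp_eq_zero hi]
  | succ k ih =>
    have h1 : ∀ i, (m i : ℝ) * (lowerTotE n ^ k) (vec (m - pile i 1)) p =
        (k ! : ℝ) * (((m i : ℝ) - p i) * chooseOp p m) := by
      intro i
      rw [← mul_chooseOp_sub]
      by_cases hi : m i = 0
      · simp [hi]
      · have := size_sub_pile (m := m) (i := i) (k := 1) (by omega)
        rw [ih _ (by omega)]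
        ring
    have h2 : ∑ i, ((m i : ℝ) - p i) = k + 1 := by
      have := congrArg (Nat.cast : ℕ → ℝ) h
      simp only [size] at this
      push_cast at this
      rw [Finset.sum_sub_distrib]
      linarith
    rw [pow_succ, Module.End.mul_apply, lowerTotE, LinearMap.sum_apply, map_sum,
      Finsupp.finsetSum_apply, ← lowerTotE]
    simp only [lowerE_vec, map_smul, Finsupp.smul_apply, smul_eq_mul, h1]
    rw [← Finset.mul_sum, ← Finset.sum_mul, h2, Nat.factorial_succ]
    push_cast; ring

lemma total_expSer_lowerTotE (p m : Config n) :
    total (expSer 1 (lowerTotE n)) p m = chooseOp p m := by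
  have hg := graded_expSer (hasDeg_lowerTotE (n := n)) 1
  rcases Nat.lt_or_ge (size m) (size p) with h | h
  · obtain ⟨i, hi⟩ := exists_lt_of_size_le h.le (by rintro rfl; exact lt_irrefl _ h)
    rw [chooseOp_eq_zero hi]
    by_contra hne
    exact absurd (le_size_of_total_ne_zero hg (by norm_num) hne) (by omega)
  · obtain ⟨k, hk⟩ := Nat.exists_eq_add_of_le h
    rw [total_apply (k := k) (by norm_num) hg (by push_cast [hk]; ring), expSer,
      PowerSeries.coeff_mk, mat_apply, LinearMap.smul_apply, Finsupp.smul_apply,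
      lowerTotE_pow_vec p k m hk, one_pow, smul_eq_mul, one_div,
      inv_mul_cancel_left₀ (by exact_mod_cast Nat.factorial_ne_zero k)]

lemma exp_SmTot : Op.exp (SmTot n) = total (expSer 1 (lowerTotE n)) := by
  rw [← mat_lowerTotE, ← exp_smul_mat, one_smul]

lemma exp_neg_SmTot : Op.exp (-SmTot n) = total (expSer (-1) (lowerTotE n)) := by
  rw [← mat_lowerTotE, ← exp_smul_mat, neg_one_smul]

end ExpLower

/-! ### Rotating the Hamiltonian and convergence of all series -/

section Boundary

variable {n : ℕ} {s : ℝ}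

lemma hasSum_vec_mul (g : Config n) (F : Config n → ℝ) :
    HasSum (fun q => vec g q * F q) (F g) := by
  have := hasSum_single (f := fun q => vec g q * F q) g fun q hq => by simp [vec_of_ne hq]
  simpa using this

lemma total_logSer_apply (x : ℝ) (i : Fin (n + 1)) (p q : Config n) :
    total (logSer x (harmE s i) (shiftE i)) p q =
      harm s (p i) * vec p q - ∑ k ∈ Finset.Icc 1 (p i), x ^ k / (k : ℝ) * vec (p - pile i k) q := by
  have hk : ∀ k, mat (PowerSeries.coeff (k + 1) (logSer x (harmE s i) (shiftE i))) p q =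
      -(x ^ (k + 1) / ((k + 1 : ℕ) : ℝ) * vec (q + pile i (k + 1)) p) := by
    intro k
    simp [logSer, mat_apply, shiftE_pow_vec]
  have h0 : mat (PowerSeries.coeff 0 (logSer x (harmE s i) (shiftE i))) p q =
      harm s (p i) * vec p q := by
    simp only [logSer, PowerSeries.coeff_mk, ↓reduceIte, mat_apply, harmE_vec, Finsupp.smul_apply,
      smul_eq_mul]
    by_cases h : p = q
    · rw [h]
    · rw [vec_of_ne h, vec_of_ne (Ne.symm h), mul_zero, mul_zero]
  rw [total, tsum_eq_sum (s := Finset.range (p i + 1)), Finset.sum_range_succ', h0, add_comm,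
    sub_eq_add_neg, ← Finset.sum_neg_distrib, sum_Icc_one]
  · congr 1
    refine Finset.sum_congr rfl fun k hk' => ?_
    rw [hk]
    congr 2
    have hle : k + 1 ≤ p i := by have := Finset.mem_range.1 hk'; omega
    by_cases h : p = q + pile i (k + 1)
    · subst h; simp
    · rw [vec_of_ne h, vec_of_ne]
      rintro rfl
      exact h (sub_pile_add_pile hle).symm
  · intro k hk'
    rcases k with _ | k
    · simp at hk'
    · rw [hk, vec_of_ne, mul_zero, neg_zero]
      rintro h
      have := congrFun h i
      rw [Pi.add_apply, pile_apply_self] at this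
      simp at hk'
      omega

lemma hasSum_total_logSer_mul (x : ℝ) (i : Fin (n + 1)) (p : Config n) (F : Config n → ℝ) :
    HasSum (fun q => total (logSer x (harmE s i) (shiftE i)) p q * F q)
      (harm s (p i) * F p - ∑ k ∈ Finset.Icc 1 (p i), x ^ k / (k : ℝ) * F (p - pile i k)) := by
  have h := ((hasSum_vec_mul p F).mul_left (harm s (p i))).sub
    (hasSum_sum (s := Finset.Icc 1 (p i)) fun k _ =>
      (hasSum_vec_mul (p - pile i k) F).mul_left (x ^ k / (k : ℝ)))
  refine (hasSum_congr fun q => ?_).1 h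
  rw [total_logSer_apply, sub_mul, Finset.sum_mul, mul_assoc]
  simp only [mul_assoc]

lemma hasSum_mul_bdry {β : ℝ} (i : Fin (n + 1)) (m : Config n) (F : Config n → ℝ) {a : ℝ}
    (ha : HasSum (fun k : ℕ => β ^ (k + 1) / ((k + 1 : ℕ) : ℝ) * F (m + pile i (k + 1))) a) :
    HasSum (fun q => F q * bdry s β i q m)
      ((harm s (m i) + ∑' k : ℕ, β ^ (k + 1) / ((k + 1 : ℕ) : ℝ)) * F m -
        ∑ k ∈ Finset.Icc 1 (m i), phi s k (m i) * F (m - pile i k) - a) := by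
  set c : ℕ → ℝ := fun k => β ^ (k + 1) / ((k + 1 : ℕ) : ℝ)
  set g : ℕ → Config n := fun k => m + pile i (k + 1) with hg
  have hinj : Function.Injective g := by
    intro k l h
    have := congrFun h i
    simp only [hg, Pi.add_apply, pile_apply_self] at this
    omega
  -- The injected configurations are pairwise distinct, so the sum over `q` is the sum over `k`
  -- reindexed.
  have hkey : HasSum (fun q => F q * ∑' k, c k * ket (g k) q) a := by
    refine (hinj.hasSum_iff ?_).1 ?_
    · intro q hq
      have : ∀ k, c k * ket (g k) q = 0 := fun k => by
        rw [ket_eq, vec_of_ne, mul_zero]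
        rintro rfl
        exact hq ⟨k, rfl⟩
      simp [this]
    · have : ∀ l, ∑' k, c k * ket (g k) (g l) = c l := fun l => by
        rw [tsum_eq_single l]
        · simp [ket]
        · intro k hk
          rw [ket_eq, vec_of_ne (fun h => hk (hinj h).symm), mul_zero]
      refine (hasSum_congr fun l => ?_).1 ha
      rw [Function.comp_apply, this, mul_comm]
  have h := (((hasSum_vec_mul m F).mul_left
    (harm s (m i) + ∑' k : ℕ, β ^ (k + 1) / ((k + 1 : ℕ) : ℝ))).sub
    (hasSum_sum (s := Finset.Icc 1 (m i)) fun k _ =>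
      (hasSum_vec_mul (m - pile i k) F).mul_left (phi s k (m i)))).sub hkey
  refine (hasSum_congr fun q => ?_).1 h
  simp only [bdry, ket_eq, mul_sub, Finset.mul_sum]
  congr 1
  congr 1
  · ring
  · exact Finset.sum_congr rfl fun k _ => by ring

/-- Neither factor makes this sum finite: convergence rests on `β < 1`. Sites other than `i`
contribute the common factor `r`, which reduces everything to `bdry_single_site`. -/
lemma hasSum_exp_mul_bdry (hs : 0 < s) {β : ℝ} (hβ : β ∈ Set.Ioo (0 : ℝ) 1) (i : Fin (n + 1))
    (p m : Config n) :
    HasSum (fun q => Op.exp (SmTot n) p q * bdry s β i q m)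
      ((total (logSer (dens β) (harmE s i) (shiftE i)) ⊠ Op.exp (SmTot n)) p m) := by
  set r : ℝ := ∏ j ∈ Finset.univ.erase i, ((m j).choose (p j) : ℝ)
  have hm : ∀ k, chooseOp p (m + pile i k) = ((m i + k).choose (p i) : ℝ) * r := fun k => by
    rw [chooseOp_eq i (p := p) (m := m) (fun _ _ => rfl)
      (fun j hj => by simp [pile_apply_of_ne hj]), Pi.add_apply, pile_apply_self]
  have hm' : ∀ k, chooseOp p (m - pile i k) = ((m i - k).choose (p i) : ℝ) * r := fun k => by
    rw [chooseOp_eq i (p := p) (m := m) (fun _ _ => rfl)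
      (fun j hj => by simp [pile_apply_of_ne hj]), Pi.sub_apply, pile_apply_self]
  have hp : ∀ k, chooseOp (p - pile i k) m = ((m i).choose (p i - k) : ℝ) * r := fun k => by
    rw [chooseOp_eq i (p := p) (m := m) (fun j hj => by simp [pile_apply_of_ne hj])
      (fun _ _ => rfl), Pi.sub_apply, pile_apply_self]
  have h0 : chooseOp p m = ((m i).choose (p i) : ℝ) * r :=
    chooseOp_eq i (fun _ _ => rfl) (fun _ _ => rfl)
  have hexp : ∀ p m : Config n, Op.exp (SmTot n) p m = chooseOp p m := fun p m => by
    rw [exp_SmTot, total_expSer_lowerTotE]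
  have hlog := (hasSum_log_mul_choose hβ (m i) (p i)).mul_right r
  have hL := hasSum_mul_bdry (s := s) (β := β) i m (chooseOp p)
    ((hasSum_congr fun k => by rw [hm, mul_assoc]).1 hlog)
  have hR := (hasSum_total_logSer_mul (s := s) (dens β) i p fun q => chooseOp q m).tsum_eq
  simp only [Op.mul, hexp]
  rw [hR]
  convert hL using 1
  simp only [hm', hp, h0, ← mul_assoc, ← Finset.sum_mul, ← sub_mul]
  rw [bdry_single_site hs]

lemma mul_add_of_summable {A B C : Op n} (hB : Op.MulSummable A B) (hC : Op.MulSummable A C) :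
    Op.MulSummable A (B + C) ∧ A ⊠ (B + C) = A ⊠ B + A ⊠ C := by
  constructor
  · intro p m
    exact ((hB p m).add (hC p m)).congr fun q => by rw [Matrix.add_apply]; ring
  · ext p m
    rw [Matrix.add_apply, Op.mul, Op.mul, Op.mul, ← (hB p m).tsum_add (hC p m)]
    exact tsum_congr fun q => by rw [Matrix.add_apply]; ring

lemma mulSummable_of_rowFinite {A : Op n} (hA : A.RowFinite) (B : Op n) : Op.MulSummable A B := by
  intro p m
  refine summable_of_hasFiniteSupport ((hA p).subset fun q hq => ?_)
  exact left_ne_zero_of_mul (Function.mem_support.1 hq)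

lemma mulSummable_of_colFinite (A : Op n) {B : Op n} (hB : ∀ m, {q | B q m ≠ 0}.Finite) :
    Op.MulSummable A B := by
  intro p m
  refine summable_of_hasFiniteSupport ((hB m).subset fun q hq => ?_)
  exact right_ne_zero_of_mul (Function.mem_support.1 hq)

lemma add_mul_of_summable {A B C : Op n} (hA : Op.MulSummable A C) (hB : Op.MulSummable B C) :
    (A + B) ⊠ C = A ⊠ C + B ⊠ C := by
  ext p m
  rw [Matrix.add_apply, Op.mul, Op.mul, Op.mul, ← (hA p m).tsum_add (hB p m)]
  exact tsum_congr fun q => by rw [Matrix.add_apply]; ring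

lemma total_colFinite {ε : ℤ} {F : PowerSeries (EndV n)} (hF : Graded ε F) (hε : ε ≤ 0)
    (m : Config n) : {q | total F q m ≠ 0}.Finite :=
  (finite_size_le (size m)).subset fun _ hq => le_size_of_total_ne_zero hF hε hq

lemma exp_SmTot_mul_ham (hs : 0 < s) {βL βR : ℝ} (hβL : βL ∈ Set.Ioo (0 : ℝ) 1)
    (hβR : βR ∈ Set.Ioo (0 : ℝ) 1) :
    Op.MulSummable (Op.exp (SmTot n)) (ham n s βL βR) ∧
      Op.exp (SmTot n) ⊠ ham n s βL βR = total (ham'E n s βL βR) ⊠ Op.exp (SmTot n) := by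
  set E := Op.exp (SmTot n) with hE
  have hg := graded_expSer (hasDeg_lowerTotE (n := n)) 1
  have hcol : ∀ m, {q | E q m ≠ 0}.Finite := fun m => by
    rw [hE, exp_SmTot]; exact total_colFinite hg (by norm_num) m
  have hbulk : E ⊠ bulkSum n s = bulkSum n s ⊠ E := by
    -- A constant series is graded for either sign of `ε`; here `-1` matches the lowering
    -- exponential.
    have hC : Graded (-1) (PowerSeries.C (bulkSumE n s)) := Graded.C hasDeg_bulkSumE
    rw [hE, exp_SmTot, ← mat_bulkSumE, ← total_C, ← total_mul (by norm_num) hg hC,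
      ← total_mul (by norm_num) hC hg, expSer_mul_C_of_commute (lowerTotE_commute_bulkSumE hs)]
  have hbulkS : Op.MulSummable E (bulkSum n s) := by
    rw [← mat_bulkSumE]; exact mulSummable_mat _ _
  have hb : ∀ {β : ℝ} (_ : β ∈ Set.Ioo (0 : ℝ) 1) (i : Fin (n + 1)),
      Op.MulSummable E (bdry s β i) ∧
        E ⊠ bdry s β i = total (logSer (dens β) (harmE s i) (shiftE i)) ⊠ E := fun hβ i =>
    ⟨fun p m => (hasSum_exp_mul_bdry hs hβ i p m).summable,
      funext fun p => funext fun m => (hasSum_exp_mul_bdry hs hβ i p m).tsum_eq⟩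
  obtain ⟨hL1, hL2⟩ := hb hβL 0
  obtain ⟨hR1, hR2⟩ := hb hβR (Fin.last n)
  obtain ⟨h1, h2⟩ := mul_add_of_summable hL1 hbulkS
  obtain ⟨h3, h4⟩ := mul_add_of_summable h1 hR1
  refine ⟨h3, ?_⟩
  have hg1 := fun β i => graded_logSer (hasDeg_dg _) (hasDeg_shiftE (n := n) i) (dens β)
    (B := harmE s i)
  have hC : Graded 1 (PowerSeries.C (bulkSumE n s)) := Graded.C hasDeg_bulkSumE
  rw [ham, h4, h2, hL2, hR2, hbulk, ham'E, total_add (by norm_num) ((hg1 _ _).add hC) (hg1 _ _),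
    total_add (by norm_num) (hg1 _ _) hC, total_C, mat_bulkSumE,
    add_mul_of_summable (mulSummable_of_colFinite _ hcol) (mulSummable_of_colFinite _ hcol),
    add_mul_of_summable (mulSummable_of_colFinite _ hcol) (mulSummable_of_colFinite _ hcol)]

lemma ham'_eq (hs : 0 < s) {βL βR : ℝ} (hβL : βL ∈ Set.Ioo (0 : ℝ) 1)
    (hβR : βR ∈ Set.Ioo (0 : ℝ) 1) : ham' n s βL βR = total (ham'E n s βL βR) := by
  have hg := fun x => graded_expSer (hasDeg_lowerTotE (n := n)) x
  have hH := graded_ham'E (n := n) s βL βR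
  have h1 : total (expSer 1 (lowerTotE n)) ⊠ total (expSer (-1) (lowerTotE n)) =
      total (1 : PowerSeries (EndV n)) := by
    rw [← total_mul (by norm_num) (hg _) (hg _), expSer_mul_expSer, add_neg_cancel, expSer_zero]
  have hone : Graded 1 (1 : PowerSeries (EndV n)) := by
    rw [← map_one PowerSeries.C]; exact Graded.C HasDeg.one
  -- After `e^{S_-} H` is rewritten as a row-finite matrix times `e^{S_-}`, the triple product may
  -- be reassociated because `e^{-S_-}` has finite columns.
  rw [ham', (exp_SmTot_mul_ham hs hβL hβR).2, exp_SmTot, exp_neg_SmTot,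
    mul_assoc_of_finite (total_rowFinite hH (by norm_num)) (total_colFinite (hg _) (by norm_num)),
    h1, ← total_mul (by norm_num) hH hone, mul_one]

lemma exp_smul_SpTot (x : ℝ) : Op.exp (x • SpTot n s) = total (expSer x (raiseTotE n s)) := by
  rw [← mat_raiseTotE, exp_smul_mat]

lemma exp_neg_smul_SpTot (x : ℝ) :
    Op.exp (-(x • SpTot n s)) = total (expSer (-x) (raiseTotE n s)) := by
  rw [← neg_smul, exp_smul_SpTot]

lemma ham''_eq (hs : 0 < s) {βL βR : ℝ} (hβL : βL ∈ Set.Ioo (0 : ℝ) 1)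
    (hβR : βR ∈ Set.Ioo (0 : ℝ) 1) : ham'' n s βL βR =
      total (logSer (dens βL - dens βR) (hamDiagE n s) (shiftE 0)) := by
  have hg := fun x => graded_expSer (hasDeg_raiseTotE (n := n) (s := s)) x
  have hH := graded_ham'E (n := n) s βL βR
  rw [ham'', ham'_eq hs hβL hβR, exp_smul_SpTot, exp_neg_smul_SpTot,
    ← total_mul (by norm_num) (hg _) hH, ← total_mul (by norm_num) ((hg _).mul hH) (hg _),
    conj_ham'E hs]

lemma seriesConverge (hs : 0 < s) {βL βR : ℝ} (hβL : βL ∈ Set.Ioo (0 : ℝ) 1)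
    (hβR : βR ∈ Set.Ioo (0 : ℝ) 1) : SeriesConverge n s βL βR := by
  have hgS := fun x => graded_expSer (hasDeg_raiseTotE (n := n) (s := s)) x
  have hH := graded_ham'E (n := n) s βL βR
  refine ⟨?_, ?_, ?_, ?_, (exp_SmTot_mul_ham hs hβL hβR).1, ?_, ?_, ?_, ?_, ?_⟩
  · rw [← one_smul ℝ (SmTot n), ← mat_lowerTotE]
    exact expSummable_smul_mat (by norm_num) hasDeg_lowerTotE 1
  · rw [← neg_one_smul ℝ (SmTot n), ← mat_lowerTotE]
    exact expSummable_smul_mat (by norm_num) hasDeg_lowerTotE (-1)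
  · rw [← mat_raiseTotE]
    exact expSummable_smul_mat (by norm_num) hasDeg_raiseTotE _
  · rw [← neg_smul, ← mat_raiseTotE]
    exact expSummable_smul_mat (by norm_num) hasDeg_raiseTotE _
  · rw [exp_neg_SmTot]
    exact mulSummable_of_colFinite _ (total_colFinite (graded_expSer hasDeg_lowerTotE _)
      (by norm_num))
  · rw [exp_neg_smul_SpTot]
    exact mulSummable_of_rowFinite (total_rowFinite (hgS _) (by norm_num)) _
  · rw [exp_neg_smul_SpTot, exp_smul_SpTot, ham'_eq hs hβL hβR,
      ← total_mul (by norm_num) (hgS _) hH]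
    exact mulSummable_total ((hgS _).mul hH) (hgS _)
  · intro k
    rw [← mat_chargeE, pow_mat]
    exact mulSummable_mat _ _
  · intro p m
    simp only [WTerm_eq hs]
    exact summable_total (by norm_num) (graded_wE s βL βR) p m

end Boundary

end HarmonicChain

end

/-! ### The main theorem -/

open HarmonicChain in
theorem proposition4p3 (n : ℕ) (s βL βR : ℝ) (hs : 0 < s)
    (hβL : βL ∈ Set.Ioo (0 : ℝ) 1) (hβR : βR ∈ Set.Ioo (0 : ℝ) 1) :
    SeriesConverge n s βL βR ∧ (ham'' n s βL βR).RowFinite ∧ (hamDiag n s).RowFinite ∧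
      ∃ Winv : Op n, (W n s βL βR).IsInverse Winv ∧
        hamDiag n s = Winv ⊠ ham'' n s βL βR ⊠ W n s βL βR := by
  have hL := graded_logSer (hasDeg_hamDiagE (n := n) (s := s)) (hasDeg_shiftE 0)
    (dens βL - dens βR)
  have hC : Graded 1 (PowerSeries.C (hamDiagE n s)) := Graded.C hasDeg_hamDiagE
  have hW := graded_wE (n := n) s βL βR
  have hV := hW.invOfUnit_one
  have h1 : wE n s βL βR * (wE n s βL βR).invOfUnit 1 = 1 :=
    PowerSeries.mul_invOfUnit _ 1 (constantCoeff_wE s βL βR)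
  have h2 : (wE n s βL βR).invOfUnit 1 * wE n s βL βR = 1 :=
    PowerSeries.invOfUnit_mul _ 1 (constantCoeff_wE s βL βR)
  -- Every matrix is now `total` of a series graded by `1`, so both the inverse and the similarity
  -- are identities in the ring of power series.
  rw [ham''_eq hs hβL hβR, W_eq hs, ← mat_hamDiagE hs, ← total_C]
  refine ⟨seriesConverge hs hβL hβR, total_rowFinite hL zero_le_one,
    total_rowFinite hC zero_le_one, total ((wE n s βL βR).invOfUnit 1),
    ⟨total_rowFinite hW zero_le_one, total_rowFinite hV zero_le_one, ?_, ?_⟩, ?_⟩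
  · rw [← total_mul one_ne_zero hW hV, h1, total_one]
  · rw [← total_mul one_ne_zero hV hW, h2, total_one]
  · rw [← total_mul one_ne_zero hV hL, ← total_mul one_ne_zero (hV.mul hL) hW, mul_assoc,
      logSer_mul_wE hs, ← mul_assoc, h2, one_mul]
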